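/- Let $K$ be a local field, that is, $K=\mathbb{R}$, $K=\mathbb{C}$ or a finite extension of $\mathbb{Q}_p$ for some prime $p$, and let $S\subset\mathbb{P}^3$ be a smooth cubic surface over $K$. Let $G_S(K)=\bigoplus_{P\in S(K)}\mathbb{Z}\cdot P$ be the free abelian group on the $K$-rational points of $S$, with degree map $\deg(\sum a_iP_i)=\sum a_i$. Let $G'_S(K)\subseteq G_S(K)$ be the subgroup generated by all sums $P+Q+R$ with $P,Q,R\in S(K)$ such that either (a) there is a line $\ell\subset\mathbb{P}^3$ defined over $K$ and not contained in $S$ with $\ell\cdot S=P+Q+R$ (counted with intersection multiplicities), or (b) there is a line $\ell$ defined over $K$ and contained in $S$ with $P,Q,R\in\ell$. Let $G''_S(K)=\{D\in G'_S(K):\deg D=0\}$ and $H_S(K)=G_S(K)/G''_S(K)$. The degree map descends to $H_S(K)$; put $H^0_S(K)=\{D\in H_S(K):\deg D=0\}$, and write $[P]\in H_S(K)$ for the class of $P\in S(K)$. Then: (i) the group $H^0_S(K)$ is finite; (ii) the map $S(K)\to H_S(K)$, $P\mapsto[P]$, is locally constant, where $S(K)$ has the topology induced by that of $K$. -/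

import Mathlib

open scoped LinearAlgebra.Projectivization

/-- A local field in the sense of this development: `K` is (topologically) isomorphic to `ℝ` or
`ℂ`, or it is a finite extension of `ℚ_[p]` for some prime `p`, with its `p`-adic topology (the
topology of a finite-dimensional `ℚ_[p]`-vector space). -/
def IsLocalField (K : Type*) [Field K] [TopologicalSpace K] : Prop :=
  (∃ e : K ≃+* ℝ, IsHomeomorph e) ∨
  (∃ e : K ≃+* ℂ, IsHomeomorph e) ∨
  (∃ (p : ℕ) (_ : Fact p.Prime) (_ : Algebra ℚ_[p] K),
    FiniteDimensional ℚ_[p] K ∧ IsModuleTopology ℚ_[p] K)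

/-- The quotient topology on the `K`-points of projective space, induced by the topology of `K`. -/
instance projectivizationTopology (K : Type*) [Field K] [TopologicalSpace K] (n : ℕ) :
    TopologicalSpace (ℙ K (Fin n → K)) :=
  TopologicalSpace.coinduced
    (fun v : {v : Fin n → K // v ≠ 0} => Projectivization.mk K v.1 v.2) inferInstance

/-- A smooth cubic surface in `ℙ³` over `K`, given by a homogeneous cubic form which has no
singular zero over an algebraic closure of `K`. (The smoothness condition forces `F ≠ 0`.) -/
structure SmoothCubicSurface (K : Type*) [Field K] where
  /-- the defining form -/
  F : MvPolynomial (Fin 4) K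
  isHomogeneous : F.IsHomogeneous 3
  smooth : ∀ x : Fin 4 → AlgebraicClosure K, x ≠ 0 → MvPolynomial.aeval x F = 0 →
    ∃ i, MvPolynomial.aeval x (MvPolynomial.pderiv i F) ≠ 0

/-- A `K`-line in `ℙ³`, i.e. a two-dimensional subspace of `K⁴`. -/
def KLine (K : Type*) [Field K] : Type _ :=
  {L : Submodule K (Fin 4 → K) // Module.finrank K L = 2}

namespace SmoothCubicSurface

variable {K : Type*} [Field K] (S : SmoothCubicSurface K)

/-- `S(K)`. -/
def Point : Type _ :=
  {P : ℙ K (Fin 4 → K) // ∀ v ∈ P.submodule, MvPolynomial.eval v S.F = 0}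

/-- `S(K)` carries the subspace topology from `ℙ³(K)`. -/
instance [TopologicalSpace K] : TopologicalSpace S.Point :=
  inferInstanceAs (TopologicalSpace
    {P : ℙ K (Fin 4 → K) // ∀ v ∈ P.submodule, MvPolynomial.eval v S.F = 0})

/-- The binary form `F(s v + t w)` in the variables `s = X 0` and `t = X 1`: the restriction of
the defining form to the line spanned by `v` and `w`. -/
noncomputable def restrict (v w : Fin 4 → K) : MvPolynomial (Fin 2) K :=
  MvPolynomial.aeval (fun i => MvPolynomial.C (v i) * MvPolynomial.X 0 +
    MvPolynomial.C (w i) * MvPolynomial.X 1) S.F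

/-- The line `ℓ` is contained in `S`: the defining form vanishes identically on `ℓ`. -/
def ContainsLine (ℓ : KLine K) : Prop :=
  ∀ v ∈ ℓ.1, ∀ w ∈ ℓ.1, S.restrict v w = 0

/-- `ℓ · S = P₀ + P₁ + P₂`, as an equality of intersection cycles. In terms of a basis `v, w` of
the line, with `Pᵢ = (aᵢ v + bᵢ w)`, it says that the binary form `F(s v + t w)` is a non-zero
constant times the product of the linear forms `bᵢ s - aᵢ t` that define the points `Pᵢ` on `ℓ`. -/
def LineSection (ℓ : KLine K) (P : Fin 3 → S.Point) : Prop :=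
  ∃ v w : Fin 4 → K, LinearIndependent K ![v, w] ∧ Submodule.span K {v, w} = ℓ.1 ∧
    ∃ (a b : Fin 3 → K) (c : K), c ≠ 0 ∧
      (∀ i, (P i).1.submodule = Submodule.span K {a i • v + b i • w}) ∧
      S.restrict v w = MvPolynomial.C c * ∏ i, (MvPolynomial.C (b i) * MvPolynomial.X 0 -
        MvPolynomial.C (a i) * MvPolynomial.X 1)

/-- The triples of `K`-points whose sums generate `G'_S(K)`. -/
def IsLineTriple (P : Fin 3 → S.Point) : Prop :=
  (∃ ℓ : KLine K, ¬ S.ContainsLine ℓ ∧ S.LineSection ℓ P) ∨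
  (∃ ℓ : KLine K, S.ContainsLine ℓ ∧ ∀ i, (P i).1.submodule ≤ ℓ.1)

/-- `G_S(K)`, the free abelian group on `S(K)`. -/
abbrev G : Type _ := S.Point →₀ ℤ

/-- `G'_S(K)`, generated by the sums `P₀ + P₁ + P₂` over the line triples. -/
noncomputable def G' : AddSubgroup S.G :=
  AddSubgroup.closure {D | ∃ P : Fin 3 → S.Point, S.IsLineTriple P ∧
    D = ∑ i, Finsupp.single (P i) 1}

/-- The degree map `∑ aᵢ Pᵢ ↦ ∑ aᵢ` on `G_S(K)`. -/
noncomputable def degG : S.G →+ ℤ :=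
  Finsupp.liftAddHom fun _ => AddMonoidHom.id ℤ

/-- `G''_S(K)`, the degree zero part of `G'_S(K)`. -/
noncomputable def G'' : AddSubgroup S.G := S.G' ⊓ S.degG.ker

/-- `H_S(K) = G_S(K) / G''_S(K)`. -/
abbrev H : Type _ := S.G ⧸ S.G''

/-- The degree map on `H_S(K)`. -/
noncomputable def deg : S.H →+ ℤ :=
  QuotientAddGroup.lift S.G'' S.degG fun _ hD => hD.2

/-- `H⁰_S(K)`, the degree zero part of `H_S(K)`. -/
noncomputable def H0 : AddSubgroup S.H := S.deg.ker

/-- The class `[P]` of a point in `H_S(K)`. -/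
noncomputable def cls (P : S.Point) : S.H :=
  QuotientAddGroup.mk (Finsupp.single P 1)

end SmoothCubicSurface

/-!
The argument rests on the symmetric trilinear polar form `tri` of the defining cubic form `F`, so
that `F(x) = tri x x x`. Points of `S(K)` are handled through representing vectors, and `vcls v` is
the class of the point represented by `v`. Any two line triples have the same class `c` in `H_S(K)`
(`exists_isLineClass`); hence `[P] + [Q] + [R] = c` whenever `P`, `Q`, `R` are collinear, and
`2 [P] + [Q] = c` whenever `Q` is a further point of the tangent plane at `P`.

*Local constancy.* Let `P` be a point whose second fundamental form does not vanish identically. The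
residual points of the lines through `P` in the tangent plane at `P` form a rational curve `r(t)`
of points of class `c - 2 [P]` (`exists_tangent_curve`), and every further point in the tangent
plane at some `r(t)` has class `c - 2 (c - 2 [P])`. For a given point `Q`, the condition that `Q`
lies in the tangent plane at `r(t)` is one polynomial equation in `t`. The Gauss map is not constant
along `r`, by smoothness (`exists_gauss_minor_ne_zero`), and therefore this equation has a simple
root for a suitable `Q` (`exists_simple_tangency`). Over a local field simple roots persist under
small changes of the coefficients, so the class is constant near `Q`. It is then constant near any
point `P₀` with `Q` outside the tangent plane at `P₀`: for `P` near `P₀`, the line joining `P` to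
the third point of the line `P₀Q` has its third point near `Q` (`eventually_vcls_eq_of_secant`).
Two uses of the persistence of roots, which makes the surface a graph near each of its points,
remove the conditions: `Q` can be moved out of any tangent plane (`exists_near_tri_ne_zero`), and
near a point with zero second fundamental form there is one where it is non-zero
(`exists_second_fundamental_form_ne_zero`).

*Finiteness.* By compactness of `S(K)` only finitely many classes `[P]` occur, so `H_S(K)` is
finitely generated. If `Q` is the residual point of a tangent line at `P`, then
`3 [Q] - c = -2 (3 [P] - c)`. The finite set of the elements `3 [P] - c` is thus carried into itself
by multiplication by `-2`, so its elements are torsion, `H⁰_S(K)` is torsion and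
hence finite.
-/

/-! ### The polar form of a cubic -/

theorem MvPolynomial.pderiv_pderiv_comm {R σ : Type*} [CommRing R] (i j : σ)
    (f : MvPolynomial σ R) : pderiv i (pderiv j f) = pderiv j (pderiv i f) := by
  classical
  have h : ⁅pderiv (R := R) i, pderiv (R := R) j⁆ = 0 := by
    refine MvPolynomial.derivation_ext fun k => ?_
    simp only [Derivation.commutator_apply, pderiv_X, Derivation.zero_apply]
    by_cases h₁ : j = k <;> by_cases h₂ : i = k <;> simp [h₁, h₂]
  have := congrArg (fun D => D f) h
  simpa [Derivation.commutator_apply, sub_eq_zero] using this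

namespace SmoothCubicSurface

variable {K : Type*} [Field K] (S : SmoothCubicSurface K)

/-- The coefficients `τ i j k = ∂ᵢ∂ⱼ∂ₖF / 6` of the polar form of the defining cubic form. -/
noncomputable def polarCoeff (i j k : Fin 4) : K :=
  MvPolynomial.coeff 0 (MvPolynomial.pderiv k (MvPolynomial.pderiv j (MvPolynomial.pderiv i S.F)))
    / 6

/-- The polar form of the defining cubic form `F`, over any `K`-algebra `A`: the symmetric
trilinear form `tri` with `F(x) = tri x x x` in characteristic zero. Its contractions describe the geometry of the
surface: the tangent plane at a point `x` is `{d | tri x x d = 0}`, and the restriction of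
`d ↦ tri x d d` to it is the second fundamental form. -/
noncomputable def tri {A : Type*} [CommRing A] [Algebra K A] (x y z : Fin 4 → A) : A :=
  ∑ i, ∑ j, ∑ k, algebraMap K A (S.polarCoeff i j k) * x i * y j * z k

section Algebra

variable {A : Type*} [CommRing A] [Algebra K A]

theorem polarCoeff_swap_left (i j k : Fin 4) : S.polarCoeff i j k = S.polarCoeff j i k := by
  rw [polarCoeff, polarCoeff, MvPolynomial.pderiv_pderiv_comm j i]

theorem polarCoeff_swap_right (i j k : Fin 4) : S.polarCoeff i j k = S.polarCoeff i k j := by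
  rw [polarCoeff, polarCoeff, MvPolynomial.pderiv_pderiv_comm k j]

theorem tri_swap_left (x y z : Fin 4 → A) : S.tri x y z = S.tri y x z := by
  rw [tri, Finset.sum_comm]
  refine Finset.sum_congr rfl fun i _ => Finset.sum_congr rfl fun j _ =>
    Finset.sum_congr rfl fun k _ => ?_
  rw [S.polarCoeff_swap_left]; ring

theorem tri_swap_right (x y z : Fin 4 → A) : S.tri x y z = S.tri x z y := by
  rw [tri]
  refine Finset.sum_congr rfl fun i _ => ?_
  rw [Finset.sum_comm]
  refine Finset.sum_congr rfl fun j _ => Finset.sum_congr rfl fun k _ => ?_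
  rw [S.polarCoeff_swap_right]; ring

theorem tri_add_left (x x' y z : Fin 4 → A) :
    S.tri (x + x') y z = S.tri x y z + S.tri x' y z := by
  simp only [tri, ← Finset.sum_add_distrib, Pi.add_apply]
  refine Finset.sum_congr rfl fun i _ => Finset.sum_congr rfl fun j _ =>
    Finset.sum_congr rfl fun k _ => ?_
  ring

theorem tri_smul_left (c : A) (x y z : Fin 4 → A) : S.tri (c • x) y z = c * S.tri x y z := by
  simp only [tri, Finset.mul_sum, Pi.smul_apply, smul_eq_mul]
  refine Finset.sum_congr rfl fun i _ => Finset.sum_congr rfl fun j _ =>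
    Finset.sum_congr rfl fun k _ => ?_
  ring

theorem tri_sub_left (x x' y z : Fin 4 → A) :
    S.tri (x - x') y z = S.tri x y z - S.tri x' y z := by
  rw [show x - x' = x + (-1 : A) • x' by simp [sub_eq_add_neg], tri_add_left, tri_smul_left]
  ring

theorem tri_add_mid (x y y' z : Fin 4 → A) :
    S.tri x (y + y') z = S.tri x y z + S.tri x y' z := by
  rw [tri_swap_left, tri_add_left, tri_swap_left, S.tri_swap_left y']

theorem tri_sub_mid (x y y' z : Fin 4 → A) :
    S.tri x (y - y') z = S.tri x y z - S.tri x y' z := by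
  rw [tri_swap_left, tri_sub_left, tri_swap_left, S.tri_swap_left y']

theorem tri_smul_mid (c : A) (x y z : Fin 4 → A) : S.tri x (c • y) z = c * S.tri x y z := by
  rw [tri_swap_left, tri_smul_left, tri_swap_left]

theorem tri_add_right (x y z z' : Fin 4 → A) :
    S.tri x y (z + z') = S.tri x y z + S.tri x y z' := by
  rw [tri_swap_right, tri_add_mid, tri_swap_right, S.tri_swap_right x z']

theorem tri_sub_right (x y z z' : Fin 4 → A) :
    S.tri x y (z - z') = S.tri x y z - S.tri x y z' := by
  rw [tri_swap_right, tri_sub_mid, tri_swap_right, S.tri_swap_right x z']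

theorem tri_smul_right (c : A) (x y z : Fin 4 → A) : S.tri x y (c • z) = c * S.tri x y z := by
  rw [tri_swap_right, tri_smul_mid, tri_swap_right]

theorem tri_zero_right (x y : Fin 4 → A) : S.tri x y 0 = 0 := by
  simpa using S.tri_smul_right 0 x y 0

theorem tri_eq_sum_single (x y z : Fin 4 → A) :
    S.tri x y z = ∑ k, z k * S.tri x y (Pi.single k 1) := by
  simp only [tri, Pi.single_apply, mul_ite, mul_one, mul_zero, Finset.sum_ite_eq',
    Finset.mem_univ, if_true, Finset.mul_sum]
  rw [Finset.sum_congr rfl fun i _ => Finset.sum_comm, Finset.sum_comm]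
  refine Finset.sum_congr rfl fun k _ => Finset.sum_congr rfl fun i _ =>
    Finset.sum_congr rfl fun j _ => ?_
  ring

theorem map_tri {B : Type*} [CommRing B] [Algebra K B] (φ : A →ₐ[K] B) (x y z : Fin 4 → A) :
    φ (S.tri x y z) = S.tri (fun i => φ (x i)) (fun i => φ (y i)) (fun i => φ (z i)) := by
  simp [tri, map_sum, map_mul]

variable [CharZero K]

theorem pderiv_eq_sum (i : Fin 4) : MvPolynomial.pderiv i S.F =
    3 * ∑ j, ∑ k, MvPolynomial.C (S.polarCoeff i j k) * MvPolynomial.X j * MvPolynomial.X k := by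
  have h₁ := S.isHomogeneous.pderiv (i := i)
  have e₁ := h₁.sum_X_mul_pderiv
  have e₂ : ∀ j, MvPolynomial.pderiv j (MvPolynomial.pderiv i S.F) =
      ∑ k, MvPolynomial.X k * (6 * MvPolynomial.C (S.polarCoeff i j k)) := fun j => by
    have h₂ := h₁.pderiv (i := j)
    have e := h₂.sum_X_mul_pderiv
    simp only [Nat.reduceSub, one_smul] at e
    rw [← e]
    refine Finset.sum_congr rfl fun k _ => ?_
    have h₃ := h₂.pderiv (i := k)
    have := (MvPolynomial.totalDegree_zero_iff_isHomogeneous _).2 h₃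
    rw [MvPolynomial.totalDegree_eq_zero_iff_eq_C.1 this, polarCoeff]
    rw [show (6 : MvPolynomial (Fin 4) K) = MvPolynomial.C 6 from rfl, ← MvPolynomial.C_mul,
      mul_div_cancel₀ _ (by norm_num : (6 : K) ≠ 0)]
  have h2 : (2 : MvPolynomial (Fin 4) K) ≠ 0 := two_ne_zero
  refine mul_left_cancel₀ h2 ?_
  have e₃ : (2 : MvPolynomial (Fin 4) K) * MvPolynomial.pderiv i S.F =
      (3 - 1) • MvPolynomial.pderiv i S.F := by simp [two_smul, two_mul]
  rw [e₃, ← e₁]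
  simp only [e₂, Finset.mul_sum]
  refine Finset.sum_congr rfl fun j _ => Finset.sum_congr rfl fun k _ => ?_
  ring

theorem aeval_pderiv (x : Fin 4 → A) (i : Fin 4) :
    MvPolynomial.aeval x (MvPolynomial.pderiv i S.F) = 3 * S.tri x x (Pi.single i 1) := by
  rw [S.tri_swap_right, S.tri_swap_left, S.pderiv_eq_sum]
  simp [tri, Pi.single_apply, map_sum]

theorem aeval_F (x : Fin 4 → A) : MvPolynomial.aeval x S.F = S.tri x x x := by
  have e := S.isHomogeneous.sum_X_mul_pderiv
  have h := congrArg (MvPolynomial.aeval x) e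
  simp only [map_sum, map_mul, MvPolynomial.aeval_X, aeval_pderiv, nsmul_eq_mul, map_natCast] at h
  rw [S.tri_eq_sum_single]
  have h3 : ∀ a b : A, 3 * a = 3 * b → a = b := fun a b hab => by
    have : algebraMap K A (3⁻¹) * 3 = 1 := by
      rw [← map_ofNat (algebraMap K A) 3, ← map_mul, inv_mul_cancel₀ three_ne_zero, map_one]
    calc a = (algebraMap K A (3⁻¹) * 3) * a := by rw [this, one_mul]
      _ = (algebraMap K A (3⁻¹) * 3) * b := by rw [mul_assoc, hab, mul_assoc]
      _ = b := by rw [this, one_mul]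
  refine h3 _ _ ?_
  rw [Finset.mul_sum]
  push_cast at h
  rw [← h]
  exact Finset.sum_congr rfl fun i _ => by ring

theorem eval_F (x : Fin 4 → K) : MvPolynomial.eval x S.F = S.tri x x x := by
  rw [← S.aeval_F, MvPolynomial.aeval_eq_eval]

end Algebra

/-- Smoothness in terms of the polar form: over an extension field, the tangent covector
`tri x x ·` at a point of the surface does not vanish. -/
theorem exists_tri_single_ne_zero [CharZero K] {x : Fin 4 → AlgebraicClosure K} (hx : x ≠ 0)
    (h : S.tri x x x = 0) : ∃ i, S.tri x x (Pi.single i 1) ≠ 0 := by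
  obtain ⟨i, hi⟩ := S.smooth x hx (by rw [S.aeval_F, h])
  rw [S.aeval_pderiv] at hi
  exact ⟨i, right_ne_zero_of_mul hi⟩

end SmoothCubicSurface

/-! ### Classes of points in terms of representing vectors -/

namespace SmoothCubicSurface

variable {K : Type*} [Field K] (S : SmoothCubicSurface K)

theorem tri_smul_smul_smul {A : Type*} [CommRing A] [Algebra K A] (a : A) (v : Fin 4 → A) :
    S.tri (a • v) (a • v) (a • v) = a ^ 3 * S.tri v v v := by
  simp only [tri_smul_left, tri_smul_mid, tri_smul_right]; ring

theorem degG_line_sum (P : Fin 3 → S.Point) :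
    S.degG (∑ i, Finsupp.single (P i) 1) = 3 := by
  simp [degG, map_sum]

theorem tri_line {A : Type*} [CommRing A] [Algebra K A] (s t : A) (v w : Fin 4 → A) :
    S.tri (s • v + t • w) (s • v + t • w) (s • v + t • w) =
      s ^ 3 * S.tri v v v + 3 * s ^ 2 * t * S.tri v v w + 3 * s * t ^ 2 * S.tri v w w
        + t ^ 3 * S.tri w w w := by
  simp only [tri_add_left, tri_add_mid, tri_add_right, tri_smul_left, tri_smul_mid,
    tri_smul_right]
  rw [S.tri_swap_left w v v, S.tri_swap_right v w v, S.tri_swap_right w w v,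
    S.tri_swap_left w v w]
  ring

theorem finrank_span_pair {v w : Fin 4 → K} (h : LinearIndependent K ![v, w]) :
    Module.finrank K (Submodule.span K {v, w}) = 2 := by
  have hr : Set.range ![v, w] = {v, w} := by
    rw [Matrix.range_cons, Matrix.range_cons, Matrix.range_empty, Set.union_empty,
      Set.singleton_union]
  rw [← hr, finrank_span_eq_card h, Fintype.card_fin]

/-- An element of `H_S(K)` which is the common class of all line triples (any element, if there are
no such triples). -/
def IsLineClass (c : S.H) : Prop :=
  ∀ P : Fin 3 → S.Point, S.IsLineTriple P → ∑ i, S.cls (P i) = c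

theorem exists_isLineClass : ∃ c, S.IsLineClass c := by
  by_cases h : ∃ P, S.IsLineTriple P
  · obtain ⟨P, hP⟩ := h
    refine ⟨∑ i, S.cls (P i), fun Q hQ => ?_⟩
    have e : ∀ R : Fin 3 → S.Point, ∑ i, S.cls (R i) =
        QuotientAddGroup.mk' S.G'' (∑ i, Finsupp.single (R i) 1) := fun R => by
      rw [map_sum]; rfl
    rw [e, e, ← sub_eq_zero, ← map_sub]
    refine (QuotientAddGroup.eq_zero_iff _).2 (AddSubgroup.mem_inf.2 ⟨?_, ?_⟩)
    · exact S.G'.sub_mem (AddSubgroup.subset_closure ⟨Q, hQ, rfl⟩)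
        (AddSubgroup.subset_closure ⟨P, hP, rfl⟩)
    · rw [AddMonoidHom.mem_ker, map_sub, degG_line_sum, degG_line_sum, sub_self]
  · exact ⟨0, fun P hP => (h ⟨P, hP⟩).elim⟩

variable [CharZero K]

/-- The point of `S(K)` represented by a non-zero vector in the cone over the surface. -/
noncomputable def pointMk (v : Fin 4 → K) (hv : v ≠ 0) (h : S.tri v v v = 0) : S.Point :=
  ⟨Projectivization.mk K v hv, fun w hw => by
    rw [Projectivization.submodule_mk, Submodule.mem_span_singleton] at hw
    obtain ⟨a, rfl⟩ := hw
    rw [S.eval_F, tri_smul_smul_smul, h, mul_zero]⟩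

theorem pointMk_submodule (v : Fin 4 → K) (hv : v ≠ 0) (h : S.tri v v v = 0) :
    (S.pointMk v hv h).1.submodule = Submodule.span K {v} :=
  Projectivization.submodule_mk _ _

theorem pointMk_rep (P : S.Point) : ∃ v hv h, P = S.pointMk v hv h := by
  refine ⟨P.1.rep, P.1.rep_nonzero, ?_, Subtype.ext P.1.mk_rep.symm⟩
  rw [← S.eval_F]
  refine P.2 _ ?_
  rw [Projectivization.submodule_eq]
  exact Submodule.mem_span_singleton_self _

open Classical in
/-- The class in `H_S(K)` of the point represented by the vector `v`; the value is `0` for a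
vector which does not represent a point of `S(K)`. -/
noncomputable def vcls (v : Fin 4 → K) : S.H :=
  if h : v ≠ 0 ∧ S.tri v v v = 0 then S.cls (S.pointMk v h.1 h.2) else 0

theorem vcls_eq {v : Fin 4 → K} (hv : v ≠ 0) (h : S.tri v v v = 0) :
    S.vcls v = S.cls (S.pointMk v hv h) :=
  dif_pos ⟨hv, h⟩

theorem vcls_smul {a : K} (ha : a ≠ 0) (v : Fin 4 → K) : S.vcls (a • v) = S.vcls v := by
  by_cases h : v ≠ 0 ∧ S.tri v v v = 0
  · have h' : S.tri (a • v) (a • v) (a • v) = 0 := by rw [tri_smul_smul_smul, h.2, mul_zero]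
    rw [S.vcls_eq h.1 h.2, S.vcls_eq (smul_ne_zero ha h.1) h']
    congr 1
    refine Subtype.ext ?_
    exact (Projectivization.mk_eq_mk_iff' K _ _ _ _).2 ⟨a, rfl⟩
  · have h' : ¬ (a • v ≠ 0 ∧ S.tri (a • v) (a • v) (a • v) = 0) := by
      rw [tri_smul_smul_smul]
      simpa [ha] using h
    rw [vcls, vcls, dif_neg h, dif_neg h']

open MvPolynomial in
theorem restrict_eq (v w : Fin 4 → K) : S.restrict v w =
    X 0 ^ 3 * C (S.tri v v v) + 3 * X 0 ^ 2 * X 1 * C (S.tri v v w) +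
      3 * X 0 * X 1 ^ 2 * C (S.tri v w w) + X 1 ^ 3 * C (S.tri w w w) := by
  have e : (fun i => C (v i) * X 0 + C (w i) * X 1 : Fin 4 → MvPolynomial (Fin 2) K) =
      (X 0 : MvPolynomial (Fin 2) K) • (fun i => C (v i)) +
        (X 1 : MvPolynomial (Fin 2) K) • (fun i => C (w i)) := by
    ext1 i; simp [mul_comm]
  have hC : ∀ x y z : Fin 4 → K, C (S.tri x y z) =
      S.tri (A := MvPolynomial (Fin 2) K) (fun i => C (x i)) (fun i => C (y i))
        (fun i => C (z i)) := fun x y z =>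
    S.map_tri (Algebra.ofId K (MvPolynomial (Fin 2) K)) x y z
  rw [restrict, S.aeval_F, e, S.tri_line, hC, hC, hC, hC]

theorem eval_restrict (v w : Fin 4 → K) (s t : K) :
    MvPolynomial.eval ![s, t] (S.restrict v w) =
      S.tri (s • v + t • w) (s • v + t • w) (s • v + t • w) := by
  rw [restrict_eq, tri_line]
  simp

variable {S} {c : S.H}

/-- If the restriction of the cubic form to a line splits into linear factors, the classes of the
corresponding three points add up to the line class. -/
theorem IsLineClass.sum_vcls_of_restrict (hc : S.IsLineClass c) {v w : Fin 4 → K}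
    (h : LinearIndependent K ![v, w]) (a b : Fin 3 → K) {k : K} (hk : k ≠ 0)
    (hx : ∀ i, a i • v + b i • w ≠ 0)
    (hr : S.restrict v w = MvPolynomial.C k * ∏ i, (MvPolynomial.C (b i) * MvPolynomial.X 0 -
        MvPolynomial.C (a i) * MvPolynomial.X 1)) :
    ∑ i, S.vcls (a i • v + b i • w) = c := by
  have hF : ∀ i, S.tri (a i • v + b i • w) (a i • v + b i • w) (a i • v + b i • w) = 0 :=
    fun i => by
      rw [← S.eval_restrict, hr, map_mul, map_prod, Finset.prod_eq_zero (Finset.mem_univ i),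
        mul_zero]
      simp [mul_comm]
  simp only [fun i => S.vcls_eq (hx i) (hF i)]
  refine hc _ (Or.inl ⟨⟨Submodule.span K {v, w}, finrank_span_pair h⟩, fun hcon => ?_,
    v, w, h, rfl, a, b, k, hk, fun i => S.pointMk_submodule _ _ _, hr⟩)
  have h0 := hcon v (Submodule.subset_span (by simp)) w (Submodule.subset_span (by simp))
  rw [hr, mul_eq_zero, Finset.prod_eq_zero_iff] at h0
  rcases h0 with h0 | ⟨i, -, h0⟩
  · exact hk (by simpa using h0)
  · refine hx i ?_
    have e₁ := congrArg (MvPolynomial.eval ![1, 0]) h0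
    have e₂ := congrArg (MvPolynomial.eval ![0, 1]) h0
    simp at e₁ e₂
    simp [e₁, e₂]

/-- Three points on a line contained in the surface. -/
theorem IsLineClass.sum_vcls_of_contained (hc : S.IsLineClass c) {v w : Fin 4 → K}
    (h : LinearIndependent K ![v, w]) (h₁ : S.tri v v v = 0) (h₂ : S.tri v v w = 0)
    (h₃ : S.tri v w w = 0) (h₄ : S.tri w w w = 0) (a b : Fin 3 → K)
    (hx : ∀ i, a i • v + b i • w ≠ 0) :
    ∑ i, S.vcls (a i • v + b i • w) = c := by
  have hF : ∀ i, S.tri (a i • v + b i • w) (a i • v + b i • w) (a i • v + b i • w) = 0 :=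
    fun i => by simp [S.tri_line, h₁, h₂, h₃, h₄]
  simp only [fun i => S.vcls_eq (hx i) (hF i)]
  refine hc _ (Or.inr ⟨⟨Submodule.span K {v, w}, finrank_span_pair h⟩, ?_, fun i => ?_⟩)
  · intro x hx' y hy
    obtain ⟨s, t, rfl⟩ := Submodule.mem_span_pair.1 hx'
    obtain ⟨s', t', rfl⟩ := Submodule.mem_span_pair.1 hy
    have g₁ : S.tri w v v = 0 := by rw [tri_swap_left, tri_swap_right, h₂]
    have g₂ : S.tri v w v = 0 := by rw [tri_swap_right, h₂]
    have g₃ : S.tri w v w = 0 := by rw [tri_swap_left, h₃]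
    have g₄ : S.tri w w v = 0 := by rw [tri_swap_right, tri_swap_left, h₃]
    rw [restrict_eq]
    simp [tri_add_left, tri_add_mid, tri_add_right, tri_smul_left, tri_smul_mid,
      tri_smul_right, h₁, h₂, h₃, h₄, g₁, g₂, g₃, g₄]
  · rw [S.pointMk_submodule, Submodule.span_singleton_le_iff_mem]
    exact Submodule.mem_span_pair.2 ⟨_, _, rfl⟩

/-- The third intersection point of the line through two points of the surface. -/
theorem IsLineClass.vcls_secant (hc : S.IsLineClass c) {u v : Fin 4 → K}
    (h : LinearIndependent K ![u, v]) (hu : S.tri u u u = 0) (hv : S.tri v v v = 0)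
    (hw : S.tri u v v • u - S.tri u u v • v ≠ 0) :
    S.vcls u + S.vcls v + S.vcls (S.tri u v v • u - S.tri u u v • v) = c := by
  have := hc.sum_vcls_of_restrict h ![1, 0, S.tri u v v] ![0, 1, -S.tri u u v]
    (k := 3) (by norm_num) (fun i => ?_) ?_
  · simpa [Fin.sum_univ_three, sub_eq_add_neg] using this
  · fin_cases i
    · simpa using h.ne_zero 0
    · simpa using h.ne_zero 1
    · simpa [sub_eq_add_neg] using hw
  · have hC3 : (MvPolynomial.C 3 : MvPolynomial (Fin 2) K) = 3 := map_ofNat _ 3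
    rw [restrict_eq, hu, hv, Fin.prod_univ_three]
    simp [hC3]
    ring

/-- The residual intersection point of a line tangent to the surface at `u`. -/
theorem IsLineClass.vcls_tangent (hc : S.IsLineClass c) {u d : Fin 4 → K}
    (h : LinearIndependent K ![u, d]) (hu : S.tri u u u = 0) (hd : S.tri u u d = 0)
    (hw : S.tri d d d • u - (3 * S.tri u d d) • d ≠ 0) :
    2 • S.vcls u + S.vcls (S.tri d d d • u - (3 * S.tri u d d) • d) = c := by
  have := hc.sum_vcls_of_restrict h ![1, 1, S.tri d d d] ![0, 0, -(3 * S.tri u d d)]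
    (k := -1) (by norm_num) (fun i => ?_) ?_
  · simpa [Fin.sum_univ_three, sub_eq_add_neg, two_smul] using this
  · fin_cases i
    · simpa using h.ne_zero 0
    · simpa using h.ne_zero 0
    · simpa [sub_eq_add_neg] using hw
  · have hC3 : (MvPolynomial.C 3 : MvPolynomial (Fin 2) K) = 3 := map_ofNat _ 3
    rw [restrict_eq, hu, hd, Fin.prod_univ_three]
    simp [hC3]
    ring

theorem IsLineClass.vcls_contained (hc : S.IsLineClass c) {u v : Fin 4 → K}
    (h : LinearIndependent K ![u, v]) (h₁ : S.tri u u u = 0) (h₂ : S.tri u u v = 0)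
    (h₃ : S.tri u v v = 0) (h₄ : S.tri v v v = 0) :
    2 • S.vcls u + S.vcls v = c := by
  have := hc.sum_vcls_of_contained h h₁ h₂ h₃ h₄ ![1, 1, 0] ![0, 0, 1] (fun i => ?_)
  · simpa [Fin.sum_univ_three, two_smul] using this
  · fin_cases i
    · simpa using h.ne_zero 0
    · simpa using h.ne_zero 0
    · simpa using h.ne_zero 1

/-- A point `v` of the surface in the tangent plane at `u` is the residual intersection of the
line through `u` and `v`, or this line is contained in the surface. -/
theorem IsLineClass.vcls_of_mem_tangentPlane (hc : S.IsLineClass c) {u v : Fin 4 → K}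
    (h : LinearIndependent K ![u, v]) (hu : S.tri u u u = 0) (hv : S.tri v v v = 0)
    (huv : S.tri u u v = 0) : 2 • S.vcls u + S.vcls v = c := by
  by_cases h₃ : S.tri u v v = 0
  · exact hc.vcls_contained h hu huv h₃ hv
  · have h3 : -(3 * S.tri u v v) ≠ 0 := neg_ne_zero.2 (mul_ne_zero three_ne_zero h₃)
    have e : S.tri v v v • u - (3 * S.tri u v v) • v = (-(3 * S.tri u v v)) • v := by
      rw [hv, zero_smul, zero_sub, neg_smul]
    have := hc.vcls_tangent h hu huv (by rw [e]; exact smul_ne_zero h3 (by simpa using h.ne_zero 1))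
    rwa [e, S.vcls_smul h3] at this

end SmoothCubicSurface

/-! ### The Gauss map along a rational curve on the surface -/

open Polynomial in
theorem exists_eval_ne_zero {K : Type*} [Field K] [Infinite K] {f : K[X]} (hf : f ≠ 0) :
    ∃ t, f.eval t ≠ 0 := by
  by_contra! h
  exact hf (Polynomial.funext fun t => by rw [h t, eval_zero])

open Polynomial in
/-- A vector of polynomials over a field is a multiple of a unimodular one. -/
theorem exists_eq_mul_unimodular {K ι : Type*} [Field K] [Fintype ι] (r : ι → K[X])
    (hr : ∃ i, r i ≠ 0) : ∃ (g : K[X]) (r' a : ι → K[X]), g ≠ 0 ∧ (∀ i, r i = g * r' i) ∧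
      ∑ i, a i * r' i = 1 := by
  obtain ⟨g, hg⟩ := (IsPrincipalIdealRing.principal (Ideal.span (Set.range r))).principal
  have hmem : ∀ i, ∃ s, r i = g * s := fun i => by
    have h : r i ∈ Ideal.span (Set.range r) := Ideal.subset_span ⟨i, rfl⟩
    rw [hg] at h
    exact Ideal.mem_span_singleton.1 h
  choose r' hr' using hmem
  have hg0 : g ≠ 0 := by
    rintro rfl
    obtain ⟨i, hi⟩ := hr
    exact hi (by rw [hr' i, zero_mul])
  have h : g ∈ Ideal.span (Set.range r) := by
    rw [hg]; exact Ideal.mem_span_singleton_self g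
  obtain ⟨a, ha⟩ := (Ideal.mem_span_range_iff_exists_fun).1 h
  refine ⟨g, r', a, hg0, hr', mul_left_cancel₀ hg0 ?_⟩
  rw [mul_one, Finset.mul_sum, ← ha]
  refine Finset.sum_congr rfl fun i _ => ?_
  rw [hr' i, ha]; ring

namespace SmoothCubicSurface

open Polynomial

variable {K : Type*} [Field K] (S : SmoothCubicSurface K)

theorem eval_tri (x y z : Fin 4 → K[X]) (t : K) : (S.tri x y z).eval t =
    S.tri (fun i => (x i).eval t) (fun i => (y i).eval t) (fun i => (z i).eval t) := by
  simpa [Polynomial.coe_aeval_eq_eval] using S.map_tri (Polynomial.aeval t) x y z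

theorem C_tri (x y z : Fin 4 → K) :
    C (S.tri x y z) = S.tri (fun i => C (x i)) (fun i => C (y i)) (fun i => C (z i)) :=
  S.map_tri (Algebra.ofId K K[X]) x y z

theorem derivative_tri (x y z : Fin 4 → K[X]) : derivative (S.tri x y z) =
    S.tri (fun i => derivative (x i)) y z + S.tri x (fun i => derivative (y i)) z +
      S.tri x y (fun i => derivative (z i)) := by
  simp only [tri, derivative_sum, ← Finset.sum_add_distrib]
  refine Finset.sum_congr rfl fun i _ => Finset.sum_congr rfl fun j _ =>
    Finset.sum_congr rfl fun k _ => ?_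
  rw [← Polynomial.C_eq_algebraMap]
  simp only [derivative_mul, derivative_C]
  ring

theorem coeff_tri (x y z : Fin 4 → K[X]) {a b c : ℕ} (hx : ∀ i, (x i).natDegree ≤ a)
    (hy : ∀ i, (y i).natDegree ≤ b) (hz : ∀ i, (z i).natDegree ≤ c) :
    (S.tri x y z).coeff (a + b + c) = S.tri (fun i => (x i).coeff a) (fun i => (y i).coeff b)
      (fun i => (z i).coeff c) := by
  simp only [tri, finsetSum_coeff]
  refine Finset.sum_congr rfl fun i _ => Finset.sum_congr rfl fun j _ =>
    Finset.sum_congr rfl fun k _ => ?_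
  rw [← Polynomial.C_eq_algebraMap]
  have h₁ : (C (S.polarCoeff i j k) * x i).natDegree ≤ a := (natDegree_C_mul_le _ _).trans (hx i)
  have h₂ : (C (S.polarCoeff i j k) * x i * y j).natDegree ≤ a + b :=
    natDegree_mul_le_of_le h₁ (hy j)
  rw [coeff_mul_add_eq_of_natDegree_le h₂ (hz k), coeff_mul_add_eq_of_natDegree_le h₁ (hy j),
    coeff_C_mul]
  rfl

/-- A vector annihilated by one covector but not by another, non-proportional, one. -/
theorem exists_tri_eq_zero_tri_ne_zero {x y z w : Fin 4 → K} {i j : Fin 4}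
    (h : S.tri x y (Pi.single i 1) * S.tri z w (Pi.single j 1) -
      S.tri x y (Pi.single j 1) * S.tri z w (Pi.single i 1) ≠ 0) :
    ∃ d, S.tri x y d = 0 ∧ S.tri z w d ≠ 0 := by
  refine ⟨S.tri x y (Pi.single i 1) • Pi.single j 1 - S.tri x y (Pi.single j 1) • Pi.single i 1,
    ?_, ?_⟩
  · rw [tri_sub_right, tri_smul_right, tri_smul_right]; ring
  · rwa [tri_sub_right, tri_smul_right, tri_smul_right]

variable [CharZero K]

/-- Smoothness at `K`-points. -/
theorem exists_tri_single_ne_zero' {x : Fin 4 → K} (hx : x ≠ 0) (h : S.tri x x x = 0) :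
    ∃ i, S.tri x x (Pi.single i 1) ≠ 0 := by
  have hm := S.map_tri (Algebra.ofId K (AlgebraicClosure K))
  obtain ⟨j, hj⟩ := Function.ne_iff.1 hx
  obtain ⟨i, hi⟩ := S.exists_tri_single_ne_zero
    (x := fun i => Algebra.ofId K (AlgebraicClosure K) (x i))
    (Function.ne_iff.2 ⟨j, by simpa using hj⟩) (by rw [← hm, h, map_zero])
  refine ⟨i, fun h0 => hi ?_⟩
  have := hm x x (Pi.single i 1)
  rw [h0, map_zero] at this
  rw [this]
  congr 1
  ext k
  by_cases hk : k = i
  · subst hk; simp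
  · simp [hk]

/-- The Gauss map is not constant along a non-constant rational curve `r` on the surface, in
infinitesimal form: some minor of the covector `N = tri r r ·` and its derivative is non-zero.
Otherwise `N`, which is unimodular by smoothness, would divide its derivative and be constant;
but its leading coefficient is the tangent covector at the point at infinity of the curve, which
sits in degree `2 deg r`. -/
theorem exists_gauss_minor_ne_zero (r a : Fin 4 → K[X]) (ha : ∑ i, a i * r i = 1)
    (hF : S.tri r r r = 0) (hr : ∃ i, (r i).natDegree ≠ 0) :
    ∃ i j, S.tri r r (Pi.single i 1) * derivative (S.tri r r (Pi.single j 1)) -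
      S.tri r r (Pi.single j 1) * derivative (S.tri r r (Pi.single i 1)) ≠ 0 := by
  by_contra! hW
  set N : Fin 4 → K[X] := fun i => S.tri r r (Pi.single i 1) with hN
  -- `N` is unimodular: a common zero over the algebraic closure would be a singular point
  obtain ⟨b, hb⟩ : ∃ b : Fin 4 → K[X], ∑ i, b i * N i = 1 := by
    obtain ⟨g, hg⟩ := (IsPrincipalIdealRing.principal (Ideal.span (Set.range N))).principal
    have hdvd : ∀ i, g ∣ N i := fun i => by
      have h : N i ∈ Ideal.span (Set.range N) := Ideal.subset_span ⟨i, rfl⟩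
      rw [hg] at h
      exact Ideal.mem_span_singleton.1 h
    have hu : IsUnit g := by
      rw [Polynomial.isUnit_iff_degree_eq_zero]
      by_contra hdeg
      obtain ⟨z, hz⟩ := IsAlgClosed.exists_aeval_eq_zero (AlgebraicClosure K) g hdeg
      have hx0 : (fun i => aeval z (r i)) ≠ 0 := fun h0 => by
        have := congrArg (aeval z) ha
        simp only [map_sum, map_mul, map_one] at this
        rw [Finset.sum_eq_zero fun i _ => by rw [show aeval z (r i) = 0 from congrFun h0 i,
          mul_zero]] at this
        exact zero_ne_one this
      obtain ⟨i, hi⟩ := S.exists_tri_single_ne_zero hx0 (by rw [← S.map_tri, hF, map_zero])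
      refine hi ?_
      obtain ⟨q, hq⟩ := hdvd i
      have h1 : aeval z (N i) = 0 := by rw [hq, map_mul, hz, zero_mul]
      rw [hN, S.map_tri] at h1
      rw [← h1]
      congr 1
      ext k
      by_cases hk : k = i
      · subst hk; simp
      · simp [hk]
    have h1 : (1 : K[X]) ∈ Ideal.span (Set.range N) := by
      rw [hg]; exact Ideal.mem_span_singleton.2 hu.dvd
    exact (Ideal.mem_span_range_iff_exists_fun).1 h1
  have hconst : ∀ i, (N i).natDegree = 0 := fun i => by
    rw [← Polynomial.derivative_eq_zero, ← Polynomial.dvd_derivative_iff]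
    refine ⟨∑ j, b j * derivative (N j), ?_⟩
    calc derivative (N i) = (∑ j, b j * N j) * derivative (N i) := by rw [hb, one_mul]
      _ = _ := by
        rw [Finset.sum_mul, Finset.mul_sum]
        refine Finset.sum_congr rfl fun j _ => ?_
        linear_combination (-b j) * hW i j
  obtain ⟨e, hle, l, hl, he⟩ : ∃ e, (∀ i, (r i).natDegree ≤ e) ∧ ∃ l, (r l).natDegree = e ∧
      e ≠ 0 := by
    obtain ⟨l, -, hl⟩ := Finset.exists_max_image Finset.univ (fun i => (r i).natDegree)
      Finset.univ_nonempty
    obtain ⟨i, hi⟩ := hr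
    refine ⟨_, fun i => hl i (Finset.mem_univ i), l, rfl, ?_⟩
    have := hl i (Finset.mem_univ i)
    omega
  have hρ : (fun i => (r i).coeff e) ≠ 0 := fun h0 => by
    have h1 : (r l).coeff e = 0 := congrFun h0 l
    rw [← hl, coeff_natDegree, leadingCoeff_eq_zero] at h1
    rw [h1, natDegree_zero] at hl
    exact he hl.symm
  obtain ⟨i, hi⟩ := S.exists_tri_single_ne_zero' hρ (by
    rw [← S.coeff_tri r r r hle hle hle, hF, coeff_zero])
  have hs : ∀ k, ((Pi.single i 1 : Fin 4 → K[X]) k).natDegree ≤ 0 := fun k => by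
    by_cases hk : k = i
    · subst hk; simp
    · simp [hk]
  have hc := S.coeff_tri r r (Pi.single i 1) hle hle hs
  have hs' : (fun k => ((Pi.single i 1 : Fin 4 → K[X]) k).coeff 0) = Pi.single i 1 := by
    ext k
    by_cases hk : k = i
    · subst hk; simp
    · simp [hk]
  rw [hs'] at hc
  refine hi (hc ▸ coeff_eq_zero_of_natDegree_lt ?_)
  have := hconst i
  simp only [hN] at this
  omega

/-- A tangent plane is not contained in the surface. -/
theorem exists_tangent_tri_ne_zero {p : Fin 4 → K} (hp : p ≠ 0) (h : S.tri p p p = 0) :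
    ∃ v, S.tri p p v = 0 ∧ S.tri v v v ≠ 0 := by
  by_contra! hW
  obtain ⟨k, hk⟩ := S.exists_tri_single_ne_zero' hp h
  set n : Fin 4 → K := fun i => S.tri p p (Pi.single i 1) with hn
  -- the vectors `f i` with `i ≠ k` form a basis of the tangent plane
  set f : Fin 4 → Fin 4 → K := fun i => Pi.single i 1 - (n i / n k) • Pi.single k 1 with hf
  have hfW : ∀ i, S.tri p p (f i) = 0 := fun i => by
    rw [hf]
    simp only [tri_sub_right, tri_smul_right]
    change n i - n i / n k * n k = 0
    rw [div_mul_cancel₀ _ hk, sub_self]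
  have hcomb : ∀ x y : Fin 4 → K, S.tri p p x = 0 → S.tri p p y = 0 → S.tri x x y = 0 := by
    intro x y hx hy
    have e₁ := hW ((1 : K) • x + (1 : K) • y) (by simp [tri_add_right, hx, hy])
    have e₂ := hW ((1 : K) • x + (-1 : K) • y) (by
      rw [tri_add_right, tri_smul_right, tri_smul_right, hx, hy]; ring)
    rw [tri_line, hW x hx, hW y hy] at e₁ e₂
    have : (6 : K) * S.tri x x y = 0 := by linear_combination e₁ - e₂
    exact (mul_eq_zero.1 this).resolve_left (by norm_num)
  have hcomb3 : ∀ x y z : Fin 4 → K, S.tri p p x = 0 → S.tri p p y = 0 → S.tri p p z = 0 →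
      S.tri x y z = 0 := by
    intro x y z hx hy hz
    have e := hcomb (x + y) z (by simp [tri_add_right, hx, hy]) hz
    rw [tri_add_left, tri_add_mid, tri_add_mid, hcomb x z hx hz, hcomb y z hy hz,
      S.tri_swap_left y x] at e
    have : (2 : K) * S.tri x y z = 0 := by linear_combination e
    exact (mul_eq_zero.1 this).resolve_left (by norm_num)
  obtain ⟨i, j, hik, hjk, hij⟩ : ∃ i j : Fin 4, i ≠ k ∧ j ≠ k ∧ i ≠ j := by
    clear * -
    revert k; decide
  have hfi : f i i = 1 := by simp [hf, hik]
  have hfj : f j i = 0 := by simp [hf, hik, hij]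
  have hfij : f i j = 0 := by simp [hf, hjk, hij.symm]
  have hfjj : f j j = 1 := by simp [hf, hjk]
  set r : Fin 4 → K[X] := (fun l => C (f i l)) + (X : K[X]) • fun l => C (f j l) with hr
  have htri : ∀ l, S.tri r r (fun m => C (f l m)) = 0 := fun l => by
    simp only [hr, tri_add_left, tri_add_mid, tri_smul_left, tri_smul_mid, ← C_tri,
      hcomb3 _ _ _ (hfW _) (hfW _) (hfW _)]
    simp
  have hN : ∀ l, S.tri r r (Pi.single l 1) = C (n l / n k) * S.tri r r (Pi.single k 1) :=
    fun l => by
      have e : (fun m => C (f l m)) = Pi.single l 1 - C (n l / n k) • Pi.single k (1 : K[X]) := by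
        ext1 m
        simp [hf, Pi.single_apply, apply_ite C]
      have h0 := htri l
      rw [e, tri_sub_right, tri_smul_right, sub_eq_zero] at h0
      exact h0
  obtain ⟨l, m, hlm⟩ := S.exists_gauss_minor_ne_zero r (Pi.single i 1) (by
      simp [Pi.single_apply, hr, hfi, hfj]) (by
      have : r = (fun l => C (f i l)) + (X : K[X]) • fun l => C (f j l) := hr
      conv_lhs => arg 4; rw [hr]
      rw [tri_add_right, tri_smul_right, htri, htri, mul_zero, add_zero])
    ⟨j, by simp [hr, hfij, hfjj]⟩
  refine hlm ?_
  rw [hN l, hN m]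
  simp only [derivative_mul, derivative_C]
  ring

end SmoothCubicSurface

/-! ### The tangent curve at a point with non-zero second fundamental form -/

namespace SmoothCubicSurface

open Polynomial

variable {K : Type*} [Field K] (S : SmoothCubicSurface K)

theorem tri_residual {A : Type*} [CommRing A] [Algebra K A] {u d : Fin 4 → A}
    (hu : S.tri u u u = 0) (hd : S.tri u u d = 0) :
    S.tri (S.tri d d d • u - (3 * S.tri u d d) • d) (S.tri d d d • u - (3 * S.tri u d d) • d)
      (S.tri d d d • u - (3 * S.tri u d d) • d) = 0 := by
  rw [sub_eq_add_neg, ← neg_smul, tri_line, hu, hd]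
  ring

/-- The tangent plane at a point has dimension at least three. -/
theorem exists_tangent_notMem_span (p d : Fin 4 → K) :
    ∃ e, S.tri p p e = 0 ∧ e ∉ Submodule.span K {p, d} := by
  by_contra! h
  let φ : (Fin 4 → K) →ₗ[K] K :=
    { toFun := fun x => S.tri p p x
      map_add' := fun x y => S.tri_add_right p p x y
      map_smul' := fun a x => S.tri_smul_right a p p x }
  have h₁ : LinearMap.ker φ ≤ Submodule.span K {p, d} := fun e he => h e he
  have h₂ := Submodule.finrank_mono h₁
  have h₃ := φ.finrank_range_add_finrank_ker
  have h₄ : Module.finrank K (LinearMap.range φ) ≤ 1 := by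
    simpa using Submodule.finrank_le (LinearMap.range φ)
  have h₅ : Module.finrank K (Submodule.span K {p, d}) ≤ 2 := by
    classical
    have := finrank_span_finset_le_card (R := K) ({p, d} : Finset (Fin 4 → K))
    rw [Finset.coe_pair] at this
    exact this.trans Finset.card_le_two
  rw [Module.finrank_fin_fun] at h₃
  omega

/-- A point and a vector of its tangent plane are independent as soon as the second fundamental
form does not vanish at the vector. -/
theorem linearIndependent_of_tri_ne_zero {p d : Fin 4 → K} (hp : p ≠ 0) (h : S.tri p p p = 0)
    (hd : S.tri p d d ≠ 0) : LinearIndependent K ![p, d] := by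
  rw [LinearIndependent.pair_iff' hp]
  rintro a rfl
  simp [tri_smul_mid, tri_smul_right, h] at hd

variable [CharZero K]

/-- The residual intersections of the lines through `p` in the tangent plane at `p` sweep out
a non-constant rational curve `r`, on whose points the class is constant. -/
theorem exists_tangent_curve {p d : Fin 4 → K} (hp : p ≠ 0) (h : S.tri p p p = 0)
    (hpd : S.tri p p d = 0) (hd : S.tri p d d ≠ 0) :
    ∃ (g : K[X]) (r a : Fin 4 → K[X]), g ≠ 0 ∧ ∑ i, a i * r i = 1 ∧ S.tri r r r = 0 ∧
      S.tri (fun i => C (p i)) (fun i => C (p i)) r = 0 ∧ (∃ i, (r i).natDegree ≠ 0) ∧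
      ∀ t, g.eval t ≠ 0 → ∀ c, S.IsLineClass c → 2 • S.vcls p + S.vcls (fun i => (r i).eval t) = c
    := by
  obtain ⟨e, hpe, he⟩ := S.exists_tangent_notMem_span p d
  have hind := S.linearIndependent_of_tri_ne_zero hp h hd
  have hind' : ∀ a b c : K, a • p + b • d + c • e = 0 → a = 0 ∧ b = 0 ∧ c = 0 := by
    intro a b c habc
    have hc : c = 0 := by
      by_contra hc
      refine he (Submodule.mem_span_pair.2 ⟨-(c⁻¹ * a), -(c⁻¹ * b), ?_⟩)
      have : c⁻¹ • (a • p + b • d + c • e) = 0 := by rw [habc, smul_zero]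
      rw [smul_add, smul_add, smul_smul, smul_smul, smul_smul, inv_mul_cancel₀ hc, one_smul] at this
      rw [← sub_eq_zero, ← neg_eq_zero, ← this]
      module
    subst hc
    rw [zero_smul, add_zero] at habc
    obtain ⟨ha, hb⟩ := LinearIndependent.pair_iff.1 hind a b habc
    exact ⟨ha, hb, rfl⟩
  -- the direction of the line with parameter `t` is `e + t d`
  set P : Fin 4 → K[X] := fun i => C (p i) with hP
  set D : Fin 4 → K[X] := (fun i => C (e i)) + (X : K[X]) • fun i => C (d i) with hD
  have hPt : ∀ t, (fun i => (P i).eval t) = p := fun t => by simp [hP]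
  have hDt : ∀ t, (fun i => (D i).eval t) = e + t • d := fun t => by
    ext i; simp [hD]; ring
  have hPP : S.tri P P P = 0 := by rw [hP, ← C_tri, h, C_0]
  have hPD : S.tri P P D = 0 := by
    rw [hP, hD, tri_add_right, tri_smul_right, ← C_tri, ← C_tri, hpe, hpd]; simp
  set q : K[X] := S.tri P D D with hq
  have hq0 : q ≠ 0 := fun h0 => by
    have : q.coeff 2 = S.tri p d d := by
      simp only [hq, hP, hD, tri_add_right, tri_add_mid, tri_smul_mid, tri_smul_right, ← C_tri]
      rw [show C (S.tri p e e) + X * C (S.tri p d e) + X * (C (S.tri p e d) +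
        X * C (S.tri p d d)) = C (S.tri p e e) + C (S.tri p d e + S.tri p e d) * X +
          C (S.tri p d d) * X ^ 2 by rw [C_add]; ring]
      simp
    rw [h0, coeff_zero] at this
    exact hd this.symm
  set w : Fin 4 → K[X] := S.tri D D D • P - (3 * q) • D with hw
  have hwt : ∀ t, (fun i => (w i).eval t) = S.tri (e + t • d) (e + t • d) (e + t • d) • p -
      (3 * S.tri p (e + t • d) (e + t • d)) • (e + t • d) := fun t => by
    have e₁ := S.eval_tri D D D t
    have e₂ := S.eval_tri P D D t
    rw [hDt] at e₁ e₂
    rw [hPt] at e₂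
    rw [← e₁, ← e₂, ← hDt t]
    ext i
    simp [hw, hP, hq]
  have hq' : ∀ t, q.eval t = S.tri p (e + t • d) (e + t • d) := fun t => by
    rw [hq, eval_tri, hPt, hDt]
  have hwne : ∀ t, q.eval t ≠ 0 → (fun i => (w i).eval t) ≠ 0 := fun t ht h0 => by
    rw [hwt, ← hq'] at h0
    obtain ⟨-, -, h1⟩ := hind' (S.tri (e + t • d) (e + t • d) (e + t • d))
      (-(3 * q.eval t * t)) (-(3 * q.eval t)) (by rw [← h0]; module)
    exact ht (by simpa using h1)
  have hwi : ∃ i, w i ≠ 0 := by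
    by_contra! h0
    obtain ⟨t, ht⟩ := exists_eval_ne_zero hq0
    exact hwne t ht (by ext i; simp [h0 i])
  obtain ⟨g, r, a, hg, hwr, ha⟩ := exists_eq_mul_unimodular w hwi
  have hwr' : w = g • r := funext hwr
  have hwrt : ∀ t, (fun i => (w i).eval t) = g.eval t • fun i => (r i).eval t := fun t => by
    ext i; simp [hwr i]
  refine ⟨g, r, a, hg, ha, ?_, ?_, ?_, ?_⟩
  · have hww : S.tri w w w = 0 := S.tri_residual hPP hPD
    rw [hwr', tri_smul_smul_smul] at hww
    exact (mul_eq_zero.1 hww).resolve_left (pow_ne_zero 3 hg)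
  · have hww : S.tri P P w = 0 := by
      rw [hw, tri_sub_right, tri_smul_right, tri_smul_right, hPP, hPD]; ring
    rw [hwr', tri_smul_right] at hww
    exact (mul_eq_zero.1 hww).resolve_left hg
  · -- two lines through `p` meet only in `p`, so a constant `r` would be equal to `p`
    by_contra! hr
    obtain ⟨t, ht⟩ := exists_eval_ne_zero (mul_ne_zero hq0 hg)
    obtain ⟨s, hs⟩ := exists_eval_ne_zero (mul_ne_zero (mul_ne_zero hq0 hg) (X_sub_C_ne_zero t))
    rw [eval_mul] at ht hs
    rw [eval_mul, eval_sub, eval_X, eval_C] at hs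
    have hst : s - t ≠ 0 := right_ne_zero_of_mul hs
    have hqs := left_ne_zero_of_mul (left_ne_zero_of_mul hs)
    have hgs := right_ne_zero_of_mul (left_ne_zero_of_mul hs)
    have hqt := left_ne_zero_of_mul ht
    have hgt := right_ne_zero_of_mul ht
    have hrc : (fun i => (r i).eval s) = fun i => (r i).eval t := by
      ext i
      rw [eq_C_of_natDegree_eq_zero (hr i), eval_C, eval_C]
    have es := hwrt s
    have et := hwrt t
    rw [hwt, ← hq'] at es et
    rw [hrc] at es
    have hz := sub_eq_zero.2 (congrArg (g.eval t • ·) es)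
    have hz' := sub_eq_zero.2 (congrArg (g.eval s • ·) et)
    have hcomb : (g.eval t * S.tri (e + s • d) (e + s • d) (e + s • d) -
        g.eval s * S.tri (e + t • d) (e + t • d) (e + t • d)) • p +
        (-(3 * (g.eval t * q.eval s * s - g.eval s * q.eval t * t))) • d +
        (-(3 * (g.eval t * q.eval s - g.eval s * q.eval t))) • e = 0 := by
      rw [← sub_self (0 : Fin 4 → K)]
      nth_rewrite 1 [← hz]
      rw [← hz']
      module
    obtain ⟨-, h1, h2⟩ := hind' _ _ _ hcomb
    have h1' : g.eval t * q.eval s * s - g.eval s * q.eval t * t = 0 := by simpa using h1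
    have h2' : g.eval t * q.eval s - g.eval s * q.eval t = 0 := by simpa using h2
    refine mul_ne_zero (mul_ne_zero hgt hqs) hst ?_
    linear_combination h1' - t * h2'
  · intro t ht c hc
    have hrt : (fun i => (r i).eval t) ≠ 0 := fun h0 => by
      have := congrArg (Polynomial.eval t) ha
      rw [eval_finsetSum, Finset.sum_eq_zero fun i _ => by
        rw [eval_mul, show (r i).eval t = 0 from congrFun h0 i, mul_zero], eval_one] at this
      exact zero_ne_one this
    have hne : (fun i => (w i).eval t) ≠ 0 := by
      rw [hwrt]; exact smul_ne_zero ht hrt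
    have hind'' : LinearIndependent K ![p, e + t • d] := by
      rw [LinearIndependent.pair_iff]
      intro x y hxy
      obtain ⟨hx, -, hy⟩ := hind' x (y * t) y (by rw [← hxy]; module)
      exact ⟨hx, hy⟩
    rw [← S.vcls_smul ht fun i => (r i).eval t, ← hwrt]
    rw [hwt] at hne ⊢
    exact hc.vcls_tangent hind'' h (by rw [tri_add_right, tri_smul_right, hpe, hpd]; simp) hne

theorem exists_add_smul_ne_zero {a b a' b' : K} (h : a ≠ 0 ∨ b ≠ 0) (h' : a' ≠ 0 ∨ b' ≠ 0) :
    ∃ s, a + s * b ≠ 0 ∧ a' + s * b' ≠ 0 := by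
  have key : ∀ {a b : K}, a ≠ 0 ∨ b ≠ 0 → (C a + X * C b : K[X]) ≠ 0 := fun {a b} h h0 => by
    have h₁ := congrArg (coeff · 0) h0
    have h₂ := congrArg (coeff · 1) h0
    simp [coeff_C] at h₁ h₂
    tauto
  obtain ⟨s, hs⟩ := exists_eval_ne_zero (mul_ne_zero (key h) (key h'))
  simp only [eval_mul, eval_add, eval_C, eval_X] at hs
  exact ⟨s, left_ne_zero_of_mul hs, right_ne_zero_of_mul hs⟩

/-- In a tangent plane of `R`, a common non-zero of two non-zero linear forms and of the second
fundamental form. -/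
theorem exists_tangent_ne_zero {R R' p x y z : Fin 4 → K} (hx : S.tri R R x = 0)
    (hx' : S.tri R R' x ≠ 0) (hy : S.tri R R y = 0) (hy' : S.tri p p y ≠ 0)
    (hz : S.tri R R z = 0) (hz' : S.tri R z z ≠ 0) :
    ∃ d, S.tri R R d = 0 ∧ S.tri R R' d ≠ 0 ∧ S.tri p p d ≠ 0 ∧ S.tri R d d ≠ 0 := by
  obtain ⟨s, hs, hs'⟩ := exists_add_smul_ne_zero (a := S.tri R R' x) (b := S.tri R R' y)
    (a' := S.tri p p x) (b' := S.tri p p y) (Or.inl hx') (Or.inr hy')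
  set v := x + s • y with hv
  have hv₁ : S.tri R R v = 0 := by rw [hv, tri_add_right, tri_smul_right, hx, hy]; ring
  have hv₂ : S.tri R R' v ≠ 0 := by rwa [hv, tri_add_right, tri_smul_right]
  have hv₃ : S.tri p p v ≠ 0 := by rwa [hv, tri_add_right, tri_smul_right]
  set f : K[X] := (C (S.tri R R' v) + X * C (S.tri R R' z)) *
    (C (S.tri p p v) + X * C (S.tri p p z)) *
    (C (S.tri R v v) + C (2 * S.tri R v z) * X + C (S.tri R z z) * X ^ 2) with hf
  have hf0 : f ≠ 0 := by
    refine mul_ne_zero (mul_ne_zero (fun h0 => ?_) fun h0 => ?_) fun h0 => ?_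
    · exact hv₂ (by simpa [coeff_C] using congrArg (coeff · 0) h0)
    · exact hv₃ (by simpa [coeff_C] using congrArg (coeff · 0) h0)
    · exact hz' (by simpa [coeff_C, coeff_X] using congrArg (coeff · 2) h0)
  obtain ⟨t, ht⟩ := exists_eval_ne_zero hf0
  simp only [hf, eval_mul, eval_add, eval_C, eval_X, eval_pow] at ht
  refine ⟨v + t • z, ?_, ?_, ?_, ?_⟩
  · rw [tri_add_right, tri_smul_right, hv₁, hz]; ring
  · rw [tri_add_right, tri_smul_right]
    exact left_ne_zero_of_mul (left_ne_zero_of_mul ht)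
  · rw [tri_add_right, tri_smul_right]
    exact right_ne_zero_of_mul (left_ne_zero_of_mul ht)
  · have := right_ne_zero_of_mul ht
    contrapose! this
    rw [← this]
    simp only [tri_add_right, tri_add_mid, tri_smul_right, tri_smul_mid]
    rw [S.tri_swap_right R z v]
    ring

/-- If the second fundamental form at `p` does not vanish, there are a rational curve `r` of
points of constant class `c - 2 [p]`, a parameter `t₀` and a point `Q` of the surface outside the
tangent plane at `p`, such that `Q` lies in the tangent plane at `r(t)` for `t = t₀`, and `t₀` is
a simple root of this condition. -/
theorem exists_simple_tangency {p d : Fin 4 → K} (hp : p ≠ 0) (h : S.tri p p p = 0)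
    (hpd : S.tri p p d = 0) (hd : S.tri p d d ≠ 0) :
    ∃ (g : K[X]) (r : Fin 4 → K[X]) (t₀ : K) (Q : Fin 4 → K),
      (∀ t, g.eval t ≠ 0 → (fun i => (r i).eval t) ≠ 0 ∧
        S.tri (fun i => (r i).eval t) (fun i => (r i).eval t) (fun i => (r i).eval t) = 0 ∧
        S.tri p p (fun i => (r i).eval t) = 0 ∧
        ∀ c, S.IsLineClass c → 2 • S.vcls p + S.vcls (fun i => (r i).eval t) = c) ∧
      g.eval t₀ ≠ 0 ∧ S.tri Q Q Q = 0 ∧ S.tri p p Q ≠ 0 ∧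
      (S.tri r r (fun i => C (Q i))).eval t₀ = 0 ∧
      (derivative (S.tri r r (fun i => C (Q i)))).eval t₀ ≠ 0 := by
  obtain ⟨g, r, a, hg, ha, hr, hpr, hdeg, hcls⟩ := S.exists_tangent_curve hp h hpd hd
  obtain ⟨i, j, hij⟩ := S.exists_gauss_minor_ne_zero r a ha hr hdeg
  obtain ⟨k, hk⟩ := S.exists_tri_single_ne_zero' hp h
  -- the tangent planes along `r` vary, so they are not all equal to the tangent plane at `p`
  obtain ⟨l, hl⟩ : ∃ l, S.tri r r (Pi.single l 1) * C (S.tri p p (Pi.single k 1)) -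
      S.tri r r (Pi.single k 1) * C (S.tri p p (Pi.single l 1)) ≠ 0 := by
    by_contra! h0
    have hC : C (S.tri p p (Pi.single k 1)) ≠ 0 := fun h1 => hk (by simpa using h1)
    refine hij (mul_left_cancel₀ (mul_ne_zero hC hC) ?_)
    have h1 := fun l => congrArg derivative (sub_eq_zero.1 (h0 l))
    simp only [derivative_mul, derivative_C, mul_zero, add_zero] at h1
    have hi := sub_eq_zero.1 (h0 i)
    have hj := sub_eq_zero.1 (h0 j)
    generalize C (S.tri p p (Pi.single k 1)) = A at *
    calc _ = (S.tri r r (Pi.single i 1) * A) * (derivative (S.tri r r (Pi.single j 1)) * A) -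
        (S.tri r r (Pi.single j 1) * A) * (derivative (S.tri r r (Pi.single i 1)) * A) := by ring
      _ = _ := by rw [hi, hj, h1 i, h1 j]; ring
  obtain ⟨t₀, ht⟩ := exists_eval_ne_zero (mul_ne_zero (mul_ne_zero hg hij) hl)
  rw [eval_mul, eval_mul] at ht
  have hgt := left_ne_zero_of_mul (left_ne_zero_of_mul ht)
  have ht₁ := right_ne_zero_of_mul (left_ne_zero_of_mul ht)
  have ht₂ := right_ne_zero_of_mul ht
  have hsingle : ∀ i, (fun m => ((Pi.single i 1 : Fin 4 → K[X]) m).eval t₀) = Pi.single i 1 :=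
    fun i => by
      ext m
      by_cases hm : m = i
      · subst hm; simp
      · simp [hm]
  set R : Fin 4 → K := fun m => (r m).eval t₀ with hR
  set R' : Fin 4 → K := fun m => (derivative (r m)).eval t₀ with hR'
  have hN : ∀ i, (S.tri r r (Pi.single i 1)).eval t₀ = S.tri R R (Pi.single i 1) := fun i => by
    rw [eval_tri, hsingle]
  have hder : ∀ x : Fin 4 → K[X], (∀ m, derivative (x m) = 0) →
      (derivative (S.tri r r x)).eval t₀ = 2 * S.tri R R' (fun m => (x m).eval t₀) := fun x hx => by
    rw [derivative_tri]
    simp only [hx]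
    rw [show (fun _ => 0 : Fin 4 → K[X]) = 0 from rfl, tri_zero_right, S.tri_swap_left _ r,
      add_zero, ← two_mul, eval_mul, eval_tri]
    simp [hR, hR']
  have hN' : ∀ i, (derivative (S.tri r r (Pi.single i 1))).eval t₀ =
      2 * S.tri R R' (Pi.single i 1) := fun i => by
    rw [hder, hsingle]
    intro m
    by_cases hm : m = i
    · subst hm; simp
    · simp [hm]
  have hRR : S.tri R R R = 0 := by rw [hR, ← eval_tri, hr, eval_zero]
  have hRR' : S.tri R R R' = 0 := by
    have h0 := congrArg (fun f => (derivative f).eval t₀) hr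
    simp only [derivative_tri, derivative_zero, eval_zero, eval_add, eval_tri] at h0
    change S.tri R' R R + S.tri R R' R + S.tri R R R' = 0 at h0
    rw [S.tri_swap_left R' R R, S.tri_swap_right R R' R] at h0
    have : (3 : K) * S.tri R R R' = 0 := by linear_combination h0
    exact (mul_eq_zero.1 this).resolve_left three_ne_zero
  have hpR : S.tri p p R = 0 := by
    have h0 := congrArg (Polynomial.eval t₀) hpr
    rw [eval_tri, eval_zero] at h0
    simpa using h0
  obtain ⟨x, hx, hx'⟩ : ∃ x, S.tri R R x = 0 ∧ S.tri R R' x ≠ 0 := by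
    refine S.exists_tri_eq_zero_tri_ne_zero (i := i) (j := j) fun h0 => ht₁ ?_
    rw [eval_sub, eval_mul, eval_mul, hN, hN, hN', hN']
    linear_combination 2 * h0
  obtain ⟨y, hy, hy'⟩ : ∃ y, S.tri R R y = 0 ∧ S.tri p p y ≠ 0 := by
    refine S.exists_tri_eq_zero_tri_ne_zero (i := l) (j := k) fun h0 => ht₂ ?_
    rw [eval_sub, eval_mul, eval_mul, hN, hN, eval_C, eval_C, h0]
  -- polarization of the second fundamental form at `R`
  obtain ⟨z, hz, hz'⟩ : ∃ z, S.tri R R z = 0 ∧ S.tri R z z ≠ 0 := by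
    by_contra! h0
    have h1 := h0 (R' + x) (by rw [tri_add_right, hRR', hx, add_zero])
    rw [tri_add_right, tri_add_mid, tri_add_mid, h0 _ hRR', h0 _ hx, S.tri_swap_right R x R'] at h1
    have : (2 : K) * S.tri R R' x = 0 := by linear_combination h1
    exact hx' ((mul_eq_zero.1 this).resolve_left two_ne_zero)
  obtain ⟨v, hv₁, hv₂, hv₃, hv₄⟩ := S.exists_tangent_ne_zero hx hx' hy hy' hz hz'
  refine ⟨g, r, t₀, S.tri v v v • R - (3 * S.tri R v v) • v, fun t ht => ⟨fun h0 => ?_, ?_, ?_,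
    hcls t ht⟩, hgt, S.tri_residual hRR hv₁, ?_, ?_, ?_⟩
  · have := congrArg (Polynomial.eval t) ha
    rw [eval_finsetSum, Finset.sum_eq_zero fun i _ => by
      rw [eval_mul, show (r i).eval t = 0 from congrFun h0 i, mul_zero], eval_one] at this
    exact zero_ne_one this
  · rw [← eval_tri, hr, eval_zero]
  · have h0 := congrArg (Polynomial.eval t) hpr
    rw [eval_tri, eval_zero] at h0
    simpa using h0
  · rw [tri_sub_right, tri_smul_right, tri_smul_right, hpR, mul_zero, zero_sub, neg_ne_zero]
    exact mul_ne_zero (mul_ne_zero three_ne_zero hv₄) hv₃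
  · rw [eval_tri]
    simp only [eval_C]
    change S.tri R R _ = 0
    rw [tri_sub_right, tri_smul_right, tri_smul_right, hRR, hv₁]; ring
  · rw [hder _ fun m => derivative_C]
    simp only [eval_C]
    change 2 * S.tri R R' (S.tri v v v • R - (3 * S.tri R v v) • v) ≠ 0
    rw [tri_sub_right, tri_smul_right, tri_smul_right, S.tri_swap_right R R' R, hRR', mul_zero,
      zero_sub]
    exact mul_ne_zero two_ne_zero (neg_ne_zero.2 (mul_ne_zero (mul_ne_zero three_ne_zero hv₄) hv₂))

end SmoothCubicSurface

/-! ### Local fields as topological fields -/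

open Topology in
/-- Simple roots persist: a polynomial whose coefficients are close to those of a given polynomial
with a simple root `t₀` has a root close to `t₀`. -/
def SimpleRootsPersist (K : Type*) [Field K] [TopologicalSpace K] : Prop :=
  ∀ (n : ℕ) (b : Fin n → K) (t₀ : K), ∑ i, b i * t₀ ^ (i : ℕ) = 0 →
    ∑ i, b i * ((i : ℕ) * t₀ ^ ((i : ℕ) - 1)) ≠ 0 →
      ∀ V ∈ 𝓝 t₀, ∀ᶠ a in 𝓝 b, ∃ t ∈ V, ∑ i : Fin n, a i * t ^ (i : ℕ) = 0

open Topology in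
/-- The properties of the topological field `K` on which the finiteness of `H⁰_S(K)` depends. -/
structure HasLocalFieldProperties (K : Type*) [Field K] [TopologicalSpace K] : Prop where
  charZero : CharZero K
  isTopologicalRing : IsTopologicalRing K
  t1Space : T1Space K
  neBot : (𝓝[≠] (0 : K)).NeBot
  /-- points of projective space have coordinates in a fixed compact set, one of them being `1` -/
  exists_isCompact : ∃ C : Set K, IsCompact C ∧
    ∀ v : Fin 4 → K, v ≠ 0 → ∃ i, v i ≠ 0 ∧ ∀ j, v j / v i ∈ C
  simpleRootsPersist : SimpleRootsPersist K

open Topology Filter in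
/-- Simple roots persist over a complete normed field, by the inverse function theorem for the map
`(a, t) ↦ (a, ∑ aᵢ tⁱ)`. -/
theorem simpleRootsPersist_of_complete (L : Type*) [NontriviallyNormedField L] [CompleteSpace L] :
    SimpleRootsPersist L := by
  intro n b t₀ h0 h1 V hV
  set D : L := ∑ i, b i * ((i : ℕ) * t₀ ^ ((i : ℕ) - 1)) with hD
  have hf : HasStrictFDerivAt (fun x : (Fin n → L) × L => ∑ i, x.1 i * x.2 ^ (i : ℕ))
      (∑ i : Fin n, (b i • (((i : ℕ) • t₀ ^ ((i : ℕ) - 1)) • ContinuousLinearMap.snd L _ L) +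
        t₀ ^ (i : ℕ) • ((ContinuousLinearMap.proj i : (Fin n → L) →L[L] L).comp
          (ContinuousLinearMap.fst L (Fin n → L) L)))) (b, t₀) := by
    refine HasStrictFDerivAt.fun_sum (𝕜 := L) fun i _ => ?_
    have h₁ : HasStrictFDerivAt (fun x : (Fin n → L) × L => x.1 i)
        ((ContinuousLinearMap.proj i : (Fin n → L) →L[L] L).comp
          (ContinuousLinearMap.fst L (Fin n → L) L)) (b, t₀) :=
      ((ContinuousLinearMap.proj i : (Fin n → L) →L[L] L).comp
        (ContinuousLinearMap.fst L (Fin n → L) L)).hasStrictFDerivAt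
    have h₂ : HasStrictFDerivAt (fun x : (Fin n → L) × L => x.2 ^ (i : ℕ))
        (((i : ℕ) • t₀ ^ ((i : ℕ) - 1)) • ContinuousLinearMap.snd L _ L) (b, t₀) :=
      (hasStrictFDerivAt_snd (𝕜 := L) (p := (b, t₀))).pow i
    exact h₁.fun_mul h₂
  have hΦ := (hasStrictFDerivAt_fst (𝕜 := L) (p := ((b, t₀) : (Fin n → L) × L))).prodMk hf
  have hmap := hΦ.map_nhds_eq_of_surj (by
    rw [LinearMap.range_eq_top]
    rintro ⟨a, s⟩
    refine ⟨(a, D⁻¹ * (s - ∑ i : Fin n, t₀ ^ (i : ℕ) * a i)), Prod.ext rfl ?_⟩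
    simp only [ContinuousLinearMap.coe_coe, ContinuousLinearMap.prod_apply,
      sum_apply, add_apply, smul_apply,
      ContinuousLinearMap.coe_snd', ContinuousLinearMap.comp_apply, ContinuousLinearMap.coe_fst',
      ContinuousLinearMap.proj_apply, smul_eq_mul, nsmul_eq_mul, Finset.sum_add_distrib]
    simp only [← mul_assoc, ← Finset.sum_mul]
    rw [show (∑ i : Fin n, b i * ((i : ℕ) : L) * t₀ ^ ((i : ℕ) - 1)) = D by
      rw [hD]; exact Finset.sum_congr rfl fun i _ => by ring]
    rw [mul_inv_cancel₀ h1]; ring)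
  have hmem : (Set.univ : Set (Fin n → L)) ×ˢ V ∈ 𝓝 ((b, t₀) : (Fin n → L) × L) :=
    prod_mem_nhds univ_mem hV
  have himg := image_mem_map (m := fun x : (Fin n → L) × L => (x.1, ∑ i, x.1 i * x.2 ^ (i : ℕ))) hmem
  rw [hmap] at himg
  simp only [h0] at himg
  have hc : Tendsto (fun a : Fin n → L => (a, (0 : L))) (𝓝 b) (𝓝 (b, 0)) :=
    (Continuous.prodMk_left (0 : L)).tendsto b
  filter_upwards [hc himg] with a ha
  obtain ⟨⟨a', t⟩, ⟨-, ht⟩, he⟩ := ha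
  obtain ⟨rfl, he'⟩ := Prod.ext_iff.1 he
  exact ⟨t, ht, he'⟩

open Topology Filter in
theorem hasLocalFieldProperties_of_homeomorph {K L : Type*} [Field K] [TopologicalSpace K]
    [NontriviallyNormedField L] [ProperSpace L] [CharZero L] (e : K ≃+* L)
    (he : IsHomeomorph e) : HasLocalFieldProperties K := by
  have hi : IsInducing e := he.isInducing
  have hmul : ContinuousMul K := hi.continuousMul e
  have hadd : ContinuousAdd K := hi.continuousAdd e
  have hsr : IsTopologicalSemiring K := ⟨⟩
  have hneg : ContinuousNeg K := IsSemitopologicalSemiring.continuousNeg_of_mul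
  have hsymm : Continuous e.symm := by
    have := he.homeomorph.continuous_symm
    convert this using 1
    ext x
    apply e.injective
    rw [e.apply_symm_apply]
    exact (he.homeomorph.apply_symm_apply x).symm
  refine ⟨charZero_of_injective_ringHom (f := (e.symm : L →+* K)) e.symm.injective, ⟨⟩,
    he.isEmbedding.t1Space, ?_, ?_, ?_⟩
  · have : Tendsto e.symm (𝓝[≠] 0) (𝓝[≠] 0) := by
      refine tendsto_nhdsWithin_of_tendsto_nhds_of_eventually_within _ ?_ ?_
      · have := hsymm.tendsto 0
        rw [map_zero] at this
        exact this.mono_left nhdsWithin_le_nhds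
      · filter_upwards [self_mem_nhdsWithin] with x hx
        simpa using hx
    exact this.neBot
  · refine ⟨e ⁻¹' Metric.closedBall 0 1, ?_, fun v hv => ?_⟩
    · exact he.homeomorph.isCompact_preimage.2 (isCompact_closedBall 0 1)
    · obtain ⟨i, -, hi⟩ := Finset.exists_max_image Finset.univ (fun i => ‖e (v i)‖)
        Finset.univ_nonempty
      have hvi : v i ≠ 0 := fun h0 => hv (by
        ext j
        have := hi j (Finset.mem_univ j)
        rw [h0, map_zero, norm_zero] at this
        simpa using this)
      refine ⟨i, hvi, fun j => ?_⟩
      have : 0 < ‖e (v i)‖ := norm_pos_iff.2 (by simpa using hvi)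
      rw [Set.mem_preimage, mem_closedBall_zero_iff, map_div₀, norm_div, div_le_one this]
      exact hi j (Finset.mem_univ j)
  · intro n b t₀ h0 h1 V hV
    have hL := simpleRootsPersist_of_complete L n (fun i => e (b i)) (e t₀)
      (by rw [← map_zero e, ← h0]; simp)
      (fun h => h1 (e.injective (by rw [map_zero, ← h]; simp)))
      (e.symm ⁻¹' V) (hsymm.continuousAt.preimage_mem_nhds (by simpa using hV))
    have hcont : Continuous fun (a : Fin n → K) i => e (a i) :=
      continuous_pi fun i => hi.continuous.comp (continuous_apply i)
    filter_upwards [hcont.continuousAt.eventually hL] with a ha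
    obtain ⟨t, ht, hz⟩ := ha
    refine ⟨e.symm t, ht, e.injective ?_⟩
    rw [map_zero, ← hz]
    simp

theorem hasLocalFieldProperties_of_padic {p : ℕ} [Fact p.Prime] {K L : Type*} [Field K]
    [TopologicalSpace K] [Algebra ℚ_[p] K] [IsModuleTopology ℚ_[p] K] [Field L]
    [Algebra ℚ_[p] L] [FiniteDimensional ℚ_[p] L] (e : K ≃ₐ[ℚ_[p]] L) :
    HasLocalFieldProperties K := by
  let _ : NontriviallyNormedField L := spectralNorm.nontriviallyNormedField ℚ_[p] L
  let _ : NormedAlgebra ℚ_[p] L := spectralNorm.normedAlgebra ℚ_[p] L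
  have : ProperSpace L := FiniteDimensional.proper ℚ_[p] L
  have : CharZero L := charZero_of_injective_algebraMap (algebraMap ℚ_[p] L).injective
  have : ContinuousAdd K := IsModuleTopology.toContinuousAdd ℚ_[p] K
  have : IsTopologicalAddGroup K := IsModuleTopology.topologicalAddGroup ℚ_[p] K
  have h₁ : Continuous e := IsModuleTopology.continuous_of_linearMap e.toLinearMap
  have h₂ : Continuous e.symm := LinearMap.continuous_of_finiteDimensional e.symm.toLinearMap
  exact hasLocalFieldProperties_of_homeomorph e.toRingEquiv
    (isHomeomorph_iff_exists_inverse.2 ⟨h₁, e.symm, e.left_inv, e.right_inv, h₂⟩)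

theorem IsLocalField.hasLocalFieldProperties {K : Type*} [Field K] [TopologicalSpace K]
    (hK : IsLocalField K) : HasLocalFieldProperties K := by
  rcases hK with ⟨e, he⟩ | ⟨e, he⟩ | ⟨p, _, _, _, _⟩
  · exact hasLocalFieldProperties_of_homeomorph e he
  · exact hasLocalFieldProperties_of_homeomorph e he
  · exact hasLocalFieldProperties_of_padic (AlgEquiv.refl (R := ℚ_[p]) (A₁ := K))

open Topology Filter Polynomial in
theorem SimpleRootsPersist.eventually_exists {K : Type*} [Field K] [TopologicalSpace K]
    (hK : SimpleRootsPersist K) {Y : Type*} [TopologicalSpace Y] (P : Y → K[X]) {n : ℕ}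
    (hn : ∀ y, (P y).natDegree < n) {y₀ : Y}
    (hP : ∀ k, ContinuousAt (fun y => (P y).coeff k) y₀) {t₀ : K} (h0 : (P y₀).eval t₀ = 0)
    (h1 : (derivative (P y₀)).eval t₀ ≠ 0) {V : Set K} (hV : V ∈ 𝓝 t₀) :
    ∀ᶠ y in 𝓝 y₀, ∃ t ∈ V, (P y).eval t = 0 := by
  have he : ∀ y t, (P y).eval t = ∑ i : Fin n, (P y).coeff i * t ^ (i : ℕ) := fun y t => by
    rw [eval_eq_sum_range' (hn y), Finset.sum_range]
  have hc : ContinuousAt (fun y => fun i : Fin n => (P y).coeff i) y₀ :=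
    continuousAt_pi.2 fun i => hP i
  have := hc.eventually (hK n (fun i => (P y₀).coeff i) t₀ (by rw [← he, h0]) (fun h => h1 (by
    rw [derivative_eval, sum_over_range' _ _ n (hn y₀), Finset.sum_range, ← h]
    · exact Finset.sum_congr rfl fun i _ => by ring
    · simp)) V hV)
  filter_upwards [this] with y hy
  obtain ⟨t, ht, hz⟩ := hy
  exact ⟨t, ht, by rw [he, hz]⟩

/-! ### Local constancy of the class -/

namespace SmoothCubicSurface

open Topology Filter Polynomial

variable {K : Type*} [Field K] (S : SmoothCubicSurface K)

theorem tri_line_add (x y : K) (p u v : Fin 4 → K) (h : S.tri p p p = 0) (hv : S.tri p p v = 0) :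
    S.tri (p + x • u + y • v) (p + x • u + y • v) (p + x • u + y • v) =
      x * (3 * S.tri p p u + 3 * x * S.tri p u u + 6 * y * S.tri p u v + x ^ 2 * S.tri u u u +
        3 * x * y * S.tri u u v + 3 * y ^ 2 * S.tri u v v) +
      y ^ 2 * (3 * S.tri p v v + y * S.tri v v v) := by
  simp only [tri_add_left, tri_add_mid, tri_add_right, tri_smul_left, tri_smul_mid,
    tri_smul_right]
  rw [S.tri_swap_left u p p, S.tri_swap_left v p p, S.tri_swap_right p u p,
    S.tri_swap_right p v p, S.tri_swap_right p v u, S.tri_swap_left u p u, S.tri_swap_right u u p,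
    S.tri_swap_left u p u, S.tri_swap_left v p v, S.tri_swap_right v v p, S.tri_swap_left v p v,
    S.tri_swap_left u p v, S.tri_swap_left v p u, S.tri_swap_right p v u,
    S.tri_swap_right u v p, S.tri_swap_left u p v, S.tri_swap_right v u p, S.tri_swap_left v p u,
    S.tri_swap_right p v u, S.tri_swap_left v u u, S.tri_swap_right u v u,
    S.tri_swap_right v v u, S.tri_swap_left v u v, h, hv]
  ring

theorem continuous_tri [TopologicalSpace K] [IsTopologicalRing K] {Y : Type*} [TopologicalSpace Y]
    {f g h : Y → Fin 4 → K} (hf : Continuous f) (hg : Continuous g) (hh : Continuous h) :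
    Continuous fun y => S.tri (f y) (g y) (h y) := by
  unfold SmoothCubicSurface.tri
  refine continuous_finsetSum _ fun i _ => continuous_finsetSum _ fun j _ =>
    continuous_finsetSum _ fun k _ => ?_
  have h₁ := (continuous_apply i).comp hf
  have h₂ := (continuous_apply j).comp hg
  have h₃ := (continuous_apply k).comp hh
  exact ((continuous_const.mul h₁).mul h₂).mul h₃

variable [CharZero K]

theorem exists_transversal {p : Fin 4 → K} (hp : p ≠ 0) (h : S.tri p p p = 0) :
    ∃ u, S.tri p p u ≠ 0 :=
  (S.exists_tri_single_ne_zero' hp h).imp' _ fun _ => id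

variable [TopologicalSpace K] [IsTopologicalRing K]

/-- The surface is locally a graph over the tangent direction `v` at `p`: it contains points
`p + x u + y v` with `(x, y)` arbitrarily small and `y ≠ 0`. -/
theorem exists_local_point (hK : SimpleRootsPersist K) (hne : (𝓝[≠] (0 : K)).NeBot)
    {p u v : Fin 4 → K} (h : S.tri p p p = 0) (hu : S.tri p p u ≠ 0) {φ : K × K → Prop}
    (hφ : ∀ᶠ z in 𝓝 (0, 0), φ z) :
    ∃ x y : K, y ≠ 0 ∧ S.tri (p + x • u + y • v) (p + x • u + y • v) (p + x • u + y • v) = 0 ∧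
      φ (x, y) := by
  obtain ⟨V, hV, V', hV', hVV⟩ := mem_nhds_prod_iff.1 hφ
  set b : K → Fin 4 → K := fun y => ![S.tri (p + y • v) (p + y • v) (p + y • v),
    3 * S.tri (p + y • v) (p + y • v) u, 3 * S.tri (p + y • v) u u, S.tri u u u] with hb
  have hroot : ∀ x y, ∑ i : Fin 4, b y i * x ^ (i : ℕ) =
      S.tri (p + x • u + y • v) (p + x • u + y • v) (p + x • u + y • v) := fun x y => by
    rw [show p + x • u + y • v = (1 : K) • (p + y • v) + x • u by module, tri_line,
      Fin.sum_univ_four]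
    simp only [hb, Matrix.cons_val, Fin.val_zero, Fin.val_one, Fin.val_two,
      show ((3 : Fin 4) : ℕ) = 3 from rfl]
    ring
  have hcb : Continuous b := by
    have hw : Continuous fun y : K => p + y • v := by fun_prop
    refine continuous_pi fun i => ?_
    fin_cases i
    · exact S.continuous_tri hw hw hw
    · exact continuous_const.mul (S.continuous_tri hw hw continuous_const)
    · exact continuous_const.mul (S.continuous_tri hw continuous_const continuous_const)
    · exact continuous_const
  have hev := hcb.continuousAt.eventually (hK 4 (b 0) 0
    (by rw [hroot]; simpa using h) (by simpa [Fin.sum_univ_four, hb] using hu) V hV)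
  obtain ⟨y, ⟨⟨x, hx, hxy⟩, hy⟩, hy0⟩ :=
    (((hev.and hV').filter_mono nhdsWithin_le_nhds).and
      (self_mem_nhdsWithin : {(0 : K)}ᶜ ∈ 𝓝[≠] 0)).exists
  exact ⟨x, y, hy0, by rwa [hroot] at hxy, hVV (Set.mk_mem_prod hx hy)⟩

variable [T1Space K]

/-- No neighbourhood of a point of the surface lies in the tangent plane at `m`. -/
theorem exists_near_tri_ne_zero (hK : SimpleRootsPersist K) (hne : (𝓝[≠] (0 : K)).NeBot)
    {m p : Fin 4 → K} (hm : m ≠ 0) (hm' : S.tri m m m = 0) (hp : p ≠ 0) (h : S.tri p p p = 0)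
    {φ : (Fin 4 → K) → Prop} (hφ : ∀ᶠ q in 𝓝 p, φ q) :
    ∃ q, S.tri q q q = 0 ∧ S.tri m m q ≠ 0 ∧ φ q := by
  by_cases hmp : S.tri m m p = 0
  swap
  · exact ⟨p, h, hmp, hφ.self_of_nhds⟩
  obtain ⟨u, hu⟩ := S.exists_transversal hp h
  have hφ' : ∀ v : Fin 4 → K, ∀ᶠ z : K × K in 𝓝 (0, 0), φ (p + z.1 • u + z.2 • v) := fun v => by
    have hc : Continuous fun z : K × K => p + z.1 • u + z.2 • v := by fun_prop
    have := hc.tendsto (0, 0)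
    simp only [zero_smul, add_zero] at this
    exact this.eventually hφ
  by_cases hv : ∃ v, S.tri p p v = 0 ∧ S.tri m m v ≠ 0
  · -- the two planes are transversal
    obtain ⟨v, hv, hmv⟩ := hv
    have hc : Continuous fun z : K × K => S.tri m m v * (3 * S.tri p p u + 3 * z.1 * S.tri p u u +
        6 * z.2 * S.tri p u v + z.1 ^ 2 * S.tri u u u + 3 * z.1 * z.2 * S.tri u u v +
        3 * z.2 ^ 2 * S.tri u v v) -
        S.tri m m u * z.2 * (3 * S.tri p v v + z.2 * S.tri v v v) := by fun_prop
    have hev := hc.continuousAt.eventually_ne (x := (0, 0)) (y := 0) (by simpa using ⟨hmv, hu⟩)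
    obtain ⟨x, y, hy, hF, hz, hq⟩ := S.exists_local_point hK hne (v := v) h hu (hev.and (hφ' v))
    refine ⟨_, hF, fun h0 => ?_, hq⟩
    rw [S.tri_line_add x y p u v h hv] at hF
    rw [tri_add_right, tri_add_right, tri_smul_right, tri_smul_right, hmp] at h0
    have hx : x * (S.tri m m v * (3 * S.tri p p u + 3 * x * S.tri p u u +
        6 * y * S.tri p u v + x ^ 2 * S.tri u u u + 3 * x * y * S.tri u u v +
        3 * y ^ 2 * S.tri u v v) - S.tri m m u * y * (3 * S.tri p v v + y * S.tri v v v)) = 0 := by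
      linear_combination S.tri m m v * hF - y * (3 * S.tri p v v + y * S.tri v v v) * h0
    rcases mul_eq_zero.1 hx with hx | hx
    · rw [hx] at h0
      exact mul_ne_zero hy hmv (by linear_combination h0)
    · exact hz hx
  · -- the two planes coincide
    push Not at hv
    obtain ⟨v, hpv, hvv⟩ := S.exists_tangent_tri_ne_zero hp h
    have hmu : S.tri m m u ≠ 0 := fun h0 => by
      obtain ⟨w, hw⟩ := S.exists_transversal hm hm'
      have := hv (S.tri p p u • w - S.tri p p w • u) (by
        rw [tri_sub_right, tri_smul_right, tri_smul_right]; ring)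
      rw [tri_sub_right, tri_smul_right, tri_smul_right, h0, mul_zero, sub_zero] at this
      exact mul_ne_zero hu hw this
    have hev : ∀ᶠ z : K × K in 𝓝 (0, 0),
        S.tri p v v = 0 ∨ 3 * S.tri p v v + z.2 * S.tri v v v ≠ 0 := by
      by_cases ha : S.tri p v v = 0
      · exact Eventually.of_forall fun _ => Or.inl ha
      · have hc : Continuous fun z : K × K => 3 * S.tri p v v + z.2 * S.tri v v v := by fun_prop
        filter_upwards [hc.continuousAt.eventually_ne (x := (0, 0)) (y := 0) (by simpa using ha)]
          with z hz
        exact Or.inr hz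
    obtain ⟨x, y, hy, hF, hz, hq⟩ := S.exists_local_point hK hne (v := v) h hu (hev.and (hφ' v))
    refine ⟨_, hF, fun h0 => ?_, hq⟩
    rw [S.tri_line_add x y p u v h hpv] at hF
    rw [tri_add_right, tri_add_right, tri_smul_right, tri_smul_right, hmp, hv v hpv] at h0
    have hx : x = 0 := (mul_eq_zero.1 (by linear_combination h0 :
      x * S.tri m m u = 0)).resolve_right hmu
    rw [hx, zero_mul, zero_add] at hF
    have hF' := (mul_eq_zero.1 hF).resolve_left (pow_ne_zero 2 hy)
    rcases hz with hz | hz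
    · rw [hz] at hF'
      exact mul_ne_zero hy hvv (by linear_combination hF')
    · exact hz hF'

/-- The surface has a point with non-zero second fundamental form: near a point `p` where this
form vanishes, it is dominated by the cubic term of the equation along a tangent direction `v`
with `tri v v v ≠ 0`. -/
theorem exists_second_fundamental_form_ne_zero (hK : SimpleRootsPersist K)
    (hne : (𝓝[≠] (0 : K)).NeBot) {p : Fin 4 → K} (hp : p ≠ 0) (h : S.tri p p p = 0) :
    ∃ q d : Fin 4 → K, q ≠ 0 ∧ S.tri q q q = 0 ∧ S.tri q q d = 0 ∧ S.tri q d d ≠ 0 := by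
  by_cases hd : ∃ d, S.tri p p d = 0 ∧ S.tri p d d ≠ 0
  · obtain ⟨d, hd⟩ := hd
    exact ⟨p, d, hp, h, hd⟩
  push Not at hd
  obtain ⟨v, hpv, hvv⟩ := S.exists_tangent_tri_ne_zero hp h
  obtain ⟨u, hu⟩ := S.exists_transversal hp h
  have hpvv := hd v hpv
  set A := S.tri p p u with hA
  set b := S.tri p u u
  set m := S.tri p u v
  set f := S.tri u u u
  set s := S.tri u u v
  set k := S.tri u v v
  set e := S.tri v v v
  -- on the surface, `x * B x y = - e * y ^ 3`
  let B : K → K → K := fun x y =>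
    3 * A + 3 * x * b + 6 * y * m + x ^ 2 * f + 3 * x * y * s + 3 * y ^ 2 * k
  let β : K → K → K := fun x y => A + 2 * x * b + 2 * y * m + x ^ 2 * f + 2 * x * y * s + y ^ 2 * k
  let G : K → K → K := fun x y => B x y - y * (2 * m + x * s + 2 * y * k)
  have hc : Continuous fun z : K × K => β z.1 z.2 * (
      z.2 ^ 3 * e * G z.1 z.2 ^ 2 * (b + z.1 * f + z.2 * s) -
      2 * z.2 * G z.1 z.2 * β z.1 z.2 * B z.1 z.2 * (m + z.1 * s + z.2 * k) +
      β z.1 z.2 ^ 2 * B z.1 z.2 * (B z.1 z.2 - z.2 ^ 2 * k)) := by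
    simp only [B, β, G]
    fun_prop
  have hev := hc.continuousAt.eventually_ne (x := (0, 0)) (y := 0) (by simpa [B, β, G] using hu)
  obtain ⟨x, y, hy, hF, hz⟩ := S.exists_local_point hK hne (v := v) h hu hev
  set R := p + x • u + y • v with hR
  have hF' : x * B x y = -(e * y ^ 3) := by
    have := S.tri_line_add x y p u v h hpv
    rw [← hR, hF, hpvv] at this
    linear_combination -this
  have hRRv : S.tri R R v = 2 * x * m + x ^ 2 * s + 2 * x * y * k + y ^ 2 * e := by
    simp only [hR, tri_add_left, tri_add_mid, tri_smul_left, tri_smul_mid]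
    rw [S.tri_swap_left u p v, S.tri_swap_left v p v, S.tri_swap_left v u v, hpv, hpvv]
    ring
  have hRRu : S.tri R R u = β x y := by
    simp only [hR, tri_add_left, tri_add_mid, tri_smul_left, tri_smul_mid]
    rw [S.tri_swap_left u p u, S.tri_swap_left v p u, S.tri_swap_right p v u,
      S.tri_swap_left v u u, S.tri_swap_right u v u, S.tri_swap_right v v u, S.tri_swap_left v u v]
    simp only [β]
    ring
  have hRuu : S.tri R u u = b + x * f + y * s := by
    simp only [hR, tri_add_left, tri_smul_left]
    rw [S.tri_swap_left v u u, S.tri_swap_right u v u]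
  have hRuv : S.tri R u v = m + x * s + y * k := by
    simp only [hR, tri_add_left, tri_smul_left]
    rw [S.tri_swap_left v u v]
  have hRvv : S.tri R v v = x * k + y * e := by
    simp only [hR, tri_add_left, tri_smul_left, hpvv]
    ring
  have hβ := left_ne_zero_of_mul hz
  have hz' := right_ne_zero_of_mul hz
  refine ⟨R, S.tri R R u • v - S.tri R R v • u, fun h0 => ?_, hF, ?_, fun h0 => ?_⟩
  · rw [h0] at hRRu
    refine hβ ?_
    rw [← hRRu, tri_swap_right, tri_zero_right]
  · rw [tri_sub_right, tri_smul_right, tri_smul_right]; ring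
  · have h1 : S.tri R (S.tri R R u • v - S.tri R R v • u) (S.tri R R u • v - S.tri R R v • u) =
        S.tri R R v ^ 2 * S.tri R u u - 2 * S.tri R R u * S.tri R R v * S.tri R u v +
          S.tri R R u ^ 2 * S.tri R v v := by
      generalize S.tri R R u = a₁
      generalize S.tri R R v = a₂
      simp only [tri_sub_mid, tri_sub_right, tri_smul_mid, tri_smul_right]
      rw [S.tri_swap_right R v u]
      ring
    rw [h1, hRuu, hRuv, hRvv, hRRu] at h0
    have h2 : B x y * S.tri R R v = y ^ 2 * e * G x y := by
      rw [hRRv]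
      simp only [G]
      linear_combination (2 * m + x * s + 2 * y * k) * hF'
    have h3 : B x y * (x * k + y * e) = y * e * (B x y - y ^ 2 * k) := by
      linear_combination k * hF'
    refine mul_ne_zero (mul_ne_zero hy hvv) hz' ?_
    change y * e * (y ^ 3 * e * G x y ^ 2 * (b + x * f + y * s) -
      2 * y * G x y * β x y * B x y * (m + x * s + y * k) +
      β x y ^ 2 * B x y * (B x y - y ^ 2 * k)) = 0
    generalize S.tri R R v = a at *
    linear_combination B x y ^ 2 * h0 - (b + x * f + y * s) * (B x y * a + y ^ 2 * e * G x y) * h2 +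
      2 * β x y * B x y * (m + x * s + y * k) * h2 - β x y ^ 2 * B x y * h3

variable {S} in
/-- The class is constant near some point of the surface. -/
theorem IsLineClass.exists_eventually_vcls_eq {c : S.H} (hc : S.IsLineClass c)
    (hK : SimpleRootsPersist K) {p d : Fin 4 → K} (hp : p ≠ 0) (h : S.tri p p p = 0)
    (hpd : S.tri p p d = 0) (hd : S.tri p d d ≠ 0) :
    ∃ Q b, Q ≠ 0 ∧ S.tri Q Q Q = 0 ∧ ∀ᶠ q in 𝓝 Q, S.tri q q q = 0 → S.vcls q = b := by
  obtain ⟨g, r, t₀, Q, hr, ht₀, hQ, hpQ, h0, h1⟩ := S.exists_simple_tangency hp h hpd hd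
  refine ⟨Q, c - 2 • (c - 2 • S.vcls p), fun hQ0 => hpQ (by rw [hQ0, tri_zero_right]), hQ, ?_⟩
  set P : (Fin 4 → K) → K[X] := fun y => S.tri r r (fun i => C (y i)) with hP
  have hsum : ∀ y, P y = ∑ k, C (y k) * S.tri r r (Pi.single k 1) := fun y =>
    S.tri_eq_sum_single _ _ _
  obtain ⟨n, hn⟩ : ∃ n, ∀ y, (P y).natDegree < n := by
    obtain ⟨n, hn⟩ := (Set.finite_range fun k =>
      (S.tri r r (Pi.single k (1 : K[X]))).natDegree).bddAbove
    refine ⟨n + 1, fun y => Nat.lt_succ_of_le ?_⟩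
    rw [hsum]
    exact natDegree_sum_le_of_forall_le _ _ fun k _ =>
      (natDegree_C_mul_le _ _).trans (hn ⟨k, rfl⟩)
  have hcoeff : ∀ k, ContinuousAt (fun y => (P y).coeff k) Q := fun k => by
    simp only [hsum, finsetSum_coeff, coeff_C_mul]
    exact (continuous_finsetSum _ fun i _ =>
      (continuous_apply i).mul continuous_const).continuousAt
  have hV : {t | g.eval t ≠ 0} ∈ 𝓝 t₀ := (g.continuous.continuousAt).eventually_ne ht₀
  have hpc : Continuous fun q => S.tri p p q :=
    S.continuous_tri continuous_const continuous_const continuous_id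
  filter_upwards [hK.eventually_exists P hn hcoeff h0 h1 hV, hpc.continuousAt.eventually_ne hpQ]
    with q hq hpq hqq
  obtain ⟨t, ht, hqt⟩ := hq
  obtain ⟨hR, hRR, hpR, hcls⟩ := hr t ht
  set R : Fin 4 → K := fun i => (r i).eval t
  have hRq : S.tri R R q = 0 := by
    rw [hP, eval_tri] at hqt
    simpa using hqt
  have hind : LinearIndependent K ![R, q] := by
    rw [LinearIndependent.pair_iff' hR]
    rintro a rfl
    exact hpq (by rw [tri_smul_right, hpR, mul_zero])
  have e₁ := hc.vcls_of_mem_tangentPlane hind hRR hqq hRq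
  rw [← hcls c hc, add_sub_cancel_left, hcls c hc, ← e₁, add_sub_cancel_left]

variable {S} in
/-- Local constancy at `Q` carries over to a point `p` with `Q` outside the tangent plane at `p`:
a point near `p` is the third intersection point of the line through a fixed point and
a point near `Q`. -/
theorem IsLineClass.eventually_vcls_eq_of_secant {c b : S.H} (hc : S.IsLineClass c)
    {p Q : Fin 4 → K} (h : S.tri p p p = 0) (hQ : S.tri Q Q Q = 0) (hpQ : S.tri p p Q ≠ 0)
    (hb : ∀ᶠ q in 𝓝 Q, S.tri q q q = 0 → S.vcls q = b) :
    ∃ b', ∀ᶠ q in 𝓝 p, S.tri q q q = 0 → S.vcls q = b' := by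
  set α := S.tri p p Q with hα
  set β := S.tri p Q Q with hβ
  set w := β • p - α • Q with hw
  have hQpp : S.tri Q p p = α := by rw [tri_swap_left, tri_swap_right]
  have hpQp : S.tri p Q p = α := by rw [tri_swap_right]
  have hQQp : S.tri Q Q p = β := by rw [tri_swap_right, tri_swap_left]
  have hQpQ : S.tri Q p Q = β := by rw [tri_swap_left]
  have hppw : S.tri p p w = -α ^ 2 := by
    rw [hw, tri_sub_right, tri_smul_right, tri_smul_right, h, ← hα]; ring
  have hpww : S.tri p w w = -(α ^ 2 * β) := by
    simp only [hw, tri_sub_right, tri_sub_mid, tri_smul_right, tri_smul_mid, h, hpQp, ← hα, ← hβ]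
    ring
  have hwww : S.tri w w w = 0 := by
    simp only [hw, tri_sub_right, tri_sub_mid, tri_sub_left, tri_smul_right, tri_smul_mid,
      tri_smul_left, h, hQ, hpQp, hQpp, hQQp, hQpQ, ← hα, ← hβ]
    ring
  -- the third intersection point of the line through `q` and `w`
  set y : (Fin 4 → K) → Fin 4 → K := fun q => S.tri q w w • q - S.tri q q w • w with hy
  have hyp : y p = (-α ^ 3) • Q := by
    rw [hy]
    simp only [hpww, hppw]
    rw [hw]
    module
  have hα3 : -α ^ 3 ≠ 0 := neg_ne_zero.2 (pow_ne_zero 3 hpQ)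
  have hcy : Continuous y := by
    have h₁ : Continuous fun q => S.tri q w w :=
      S.continuous_tri continuous_id continuous_const continuous_const
    have h₂ : Continuous fun q => S.tri q q w :=
      S.continuous_tri continuous_id continuous_id continuous_const
    exact (h₁.smul continuous_id).sub (h₂.smul continuous_const)
  have hlim : Tendsto (fun q => (-α ^ 3)⁻¹ • y q) (𝓝 p) (𝓝 Q) := by
    have := (hcy.tendsto p).const_smul ((-α ^ 3)⁻¹)
    rwa [hyp, smul_smul, inv_mul_cancel₀ hα3, one_smul] at this
  have hcw : Continuous fun q => S.tri q q w :=
    S.continuous_tri continuous_id continuous_id continuous_const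
  refine ⟨c - S.vcls w - b, ?_⟩
  filter_upwards [hlim.eventually hb, hcw.continuousAt.eventually_ne
    (show S.tri p p w ≠ 0 by rw [hppw]; exact neg_ne_zero.2 (pow_ne_zero 2 hpQ))] with q hq hqw hqq
  have hq0 : q ≠ 0 := by
    rintro rfl
    exact hqw (by rw [tri_swap_right, tri_zero_right])
  have hind : LinearIndependent K ![q, w] := by
    rw [LinearIndependent.pair_iff' hq0]
    intro a ha
    exact hqw (by rw [← ha, tri_smul_right, hqq, mul_zero])
  have hyq0 : y q ≠ 0 := fun h0 => by
    have := LinearIndependent.pair_iff.1 hind (S.tri q w w) (-S.tri q q w) (by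
      rw [← h0, hy]; module)
    exact hqw (neg_eq_zero.1 this.2)
  have hsec := hc.vcls_secant hind hqq hwww hyq0
  have hyy : S.tri (y q) (y q) (y q) = 0 := by
    change S.tri (S.tri q w w • q - S.tri q q w • w) (S.tri q w w • q - S.tri q q w • w)
      (S.tri q w w • q - S.tri q q w • w) = 0
    rw [sub_eq_add_neg, ← neg_smul, tri_line, hqq, hwww]
    ring
  have hyb : S.vcls (y q) = b := by
    rw [← S.vcls_smul (inv_ne_zero hα3)]
    exact hq (by rw [tri_smul_smul_smul, hyy, mul_zero])
  rw [← hsec, ← hyb]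
  change S.vcls q = S.vcls q + S.vcls w + S.vcls (y q) - S.vcls w - S.vcls (y q)
  abel

theorem eventually_vcls_eq (hK : SimpleRootsPersist K) (hne : (𝓝[≠] (0 : K)).NeBot)
    {p : Fin 4 → K} (hp : p ≠ 0) (h : S.tri p p p = 0) :
    ∀ᶠ q in 𝓝 p, S.tri q q q = 0 → S.vcls q = S.vcls p := by
  obtain ⟨c, hc⟩ := S.exists_isLineClass
  obtain ⟨p', d, hp', hpp', hd, hd'⟩ := S.exists_second_fundamental_form_ne_zero hK hne hp h
  obtain ⟨Q, b, hQ0, hQ, hb⟩ := hc.exists_eventually_vcls_eq hK hp' hpp' hd hd'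
  obtain ⟨q, hq, hpq, hqb⟩ :=
    S.exists_near_tri_ne_zero hK hne hp h hQ0 hQ (eventually_eventually_nhds.2 hb)
  obtain ⟨b', hb'⟩ := hc.eventually_vcls_eq_of_secant h hq hpq hqb
  filter_upwards [hb'] with x hx hxx
  rw [hx hxx, hb'.self_of_nhds h]

end SmoothCubicSurface

/-! ### Finiteness -/

namespace SmoothCubicSurface

open Topology Filter

variable {K : Type*} [Field K] (S : SmoothCubicSurface K) [CharZero K]

theorem cls_eq_vcls (P : S.Point) : ∃ v, v ≠ 0 ∧ S.tri v v v = 0 ∧ S.cls P = S.vcls v := by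
  obtain ⟨v, hv, h, rfl⟩ := S.pointMk_rep P
  exact ⟨v, hv, h, (S.vcls_eq hv h).symm⟩

theorem isLocallyConstant_cls [TopologicalSpace K] [IsTopologicalRing K] [T1Space K]
    (hK : SimpleRootsPersist K) (hne : (𝓝[≠] (0 : K)).NeBot) : IsLocallyConstant S.cls := by
  intro A
  -- the open subset of projective space is the union of `cls ⁻¹' A` and the complement of `S(K)`
  refine isOpen_induced_iff.2 ⟨{P | ∀ h, S.cls ⟨P, h⟩ ∈ A}, ?_, ?_⟩
  · rw [isOpen_coinduced, isOpen_iff_mem_nhds]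
    rintro ⟨v, hv⟩ hvA
    have hcF : Continuous fun q : {v : Fin 4 → K // v ≠ 0} => S.tri q.1 q.1 q.1 :=
      S.continuous_tri continuous_subtype_val continuous_subtype_val continuous_subtype_val
    have hmem : ∀ (q : {v : Fin 4 → K // v ≠ 0}),
        (S.tri q.1 q.1 q.1 = 0 → S.vcls q.1 ∈ A) →
          ∀ h, S.cls ⟨Projectivization.mk K q.1 q.2, h⟩ ∈ A := by
      intro q hq h
      have hF : S.tri q.1 q.1 q.1 = 0 := by
        rw [← S.eval_F]
        refine h _ ?_
        rw [Projectivization.submodule_mk]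
        exact Submodule.mem_span_singleton_self _
      have := hq hF
      rwa [S.vcls_eq q.2 hF] at this
    by_cases hF : S.tri v v v = 0
    · have hvA' : S.vcls v ∈ A := by
        rw [S.vcls_eq hv hF]
        exact hvA (S.pointMk v hv hF).2
      have hev := (continuous_subtype_val.tendsto
        (⟨v, hv⟩ : {v : Fin 4 → K // v ≠ 0})).eventually (S.eventually_vcls_eq hK hne hv hF)
      filter_upwards [hev] with q hq
      exact hmem q fun h => by rwa [hq h]
    · have hU : {q : {v : Fin 4 → K // v ≠ 0} | S.tri q.1 q.1 q.1 ≠ 0} ∈ 𝓝 ⟨v, hv⟩ :=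
        (isOpen_compl_singleton.preimage hcF).mem_nhds hF
      filter_upwards [hU] with q hq
      exact hmem q fun h => (hq h).elim
  · ext P
    exact ⟨fun h => h P.2, fun h _ => h⟩

/-- By compactness of `S(K)`, only finitely many classes of points occur. -/
theorem finite_range_cls [TopologicalSpace K] [IsTopologicalRing K] [T1Space K]
    (hK : SimpleRootsPersist K) (hne : (𝓝[≠] (0 : K)).NeBot) {C : Set K} (hC : IsCompact C)
    (hCv : ∀ v : Fin 4 → K, v ≠ 0 → ∃ i, v i ≠ 0 ∧ ∀ j, v j / v i ∈ C) :
    (Set.range S.cls).Finite := by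
  have hcF : Continuous fun q : Fin 4 → K => S.tri q q q :=
    S.continuous_tri continuous_id continuous_id continuous_id
  set Z : Fin 4 → Set (Fin 4 → K) := fun i =>
    Set.univ.pi (fun _ => C) ∩ ({v | v i = 1} ∩ {v | S.tri v v v = 0}) with hZ
  have hZc : ∀ i, IsCompact (Z i) := fun i =>
    (isCompact_univ_pi fun _ => hC).inter_right
      ((isClosed_singleton.preimage (continuous_apply i)).inter (isClosed_singleton.preimage hcF))
  have hfin : ∀ i, (S.vcls '' Z i).Finite := fun i => by
    have hlc : ∀ v ∈ Z i, ∃ t ∈ 𝓝[Z i] v, (S.vcls '' t).Finite := fun v hv => by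
      have hv0 : v ≠ 0 := fun h0 => by
        have h1 : v i = 1 := hv.2.1
        rw [h0] at h1
        exact zero_ne_one h1
      refine ⟨{q | S.tri q q q = 0 → S.vcls q = S.vcls v} ∩ Z i,
        inter_mem (mem_nhdsWithin_of_mem_nhds (S.eventually_vcls_eq hK hne hv0 hv.2.2))
          self_mem_nhdsWithin, (Set.finite_singleton (S.vcls v)).subset ?_⟩
      rintro _ ⟨q, ⟨hq, hqZ⟩, rfl⟩
      exact hq hqZ.2.2
    refine (hZc i).induction_on (p := fun t => (S.vcls '' t).Finite) (by simp)
      (fun s t hst ht => ht.subset (Set.image_mono hst))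
      (fun s t hs ht => by rw [Set.image_union]; exact hs.union ht) hlc
  refine (Set.finite_iUnion hfin).subset ?_
  rintro _ ⟨P, rfl⟩
  obtain ⟨v, hv, hF, hP⟩ := S.cls_eq_vcls P
  obtain ⟨i, hi, hj⟩ := hCv v hv
  refine Set.mem_iUnion.2 ⟨i, (v i)⁻¹ • v, ⟨fun j _ => ?_, ?_, ?_⟩, ?_⟩
  · have := hj j
    rwa [div_eq_inv_mul] at this
  · simp [hi]
  · change S.tri _ _ _ = 0
    rw [tri_smul_smul_smul, hF, mul_zero]
  · rw [S.vcls_smul (inv_ne_zero hi), hP]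

variable {S} in
/-- A tangent line at a point meets the surface in a further `K`-point. -/
theorem IsLineClass.exists_two_smul_cls_add_cls {c : S.H} (hc : S.IsLineClass c) (P : S.Point) :
    ∃ Q, 2 • S.cls P + S.cls Q = c := by
  obtain ⟨p, hp, h, hP⟩ := S.cls_eq_vcls P
  obtain ⟨d, hpd, hd⟩ := S.exists_tangent_notMem_span p p
  have hind : LinearIndependent K ![p, d] := by
    rw [LinearIndependent.pair_iff' hp]
    rintro a rfl
    exact hd (Submodule.smul_mem _ _ (Submodule.subset_span (by simp)))
  by_cases hw : S.tri d d d • p - (3 * S.tri p d d) • d = 0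
  · have := LinearIndependent.pair_iff.1 hind (S.tri d d d) (-(3 * S.tri p d d)) (by
      rw [← hw]; module)
    have hpdd : S.tri p d d = 0 := by simpa using this.2
    refine ⟨S.pointMk d (by simpa using hind.ne_zero 1) this.1, ?_⟩
    rw [hP, ← S.vcls_eq]
    exact hc.vcls_contained hind h hpd hpdd this.1
  · refine ⟨S.pointMk _ hw (S.tri_residual h hpd), ?_⟩
    rw [hP, ← S.vcls_eq]
    exact hc.vcls_tangent hind h hpd hw

variable {S} in
/-- Multiplication by `-2` carries the finite set of the elements `3 [P] - c` into itself, by the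
tangent construction, so these elements are torsion. -/
theorem IsLineClass.exists_zsmul_eq_zero {c : S.H} (hc : S.IsLineClass c)
    (hfin : (Set.range S.cls).Finite) (P : S.Point) :
    ∃ n : ℤ, n ≠ 0 ∧ n • (3 • S.cls P - c) = 0 := by
  have hstep : ∀ n : ℕ, ∃ Q, (-2 : ℤ) ^ n • (3 • S.cls P - c) = 3 • S.cls Q - c := by
    intro n
    induction n with
    | zero => exact ⟨P, by simp⟩
    | succ n ih =>
      obtain ⟨Q, hQ⟩ := ih
      obtain ⟨R, hR⟩ := hc.exists_two_smul_cls_add_cls Q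
      refine ⟨R, ?_⟩
      rw [pow_succ', mul_smul, hQ, ← hR]
      module
  have hfin' : (Set.range fun n : ℕ => (-2 : ℤ) ^ n • (3 • S.cls P - c)).Finite := by
    refine (hfin.image fun x => 3 • x - c).subset ?_
    rintro _ ⟨n, rfl⟩
    obtain ⟨Q, hQ⟩ := hstep n
    exact ⟨_, ⟨Q, rfl⟩, hQ.symm⟩
  have hninj : ¬ Function.Injective fun n : ℕ => (-2 : ℤ) ^ n • (3 • S.cls P - c) := fun hinj =>
    Set.infinite_range_of_injective hinj hfin'
  obtain ⟨m, n, hmn, hne⟩ := Function.not_injective_iff.1 hninj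
  refine ⟨(-2) ^ m - (-2) ^ n, fun h0 => hne ?_, ?_⟩
  · exact Int.pow_right_injective (by norm_num) (sub_eq_zero.1 h0)
  · rw [sub_smul, sub_eq_zero]
    exact hmn

theorem finite_H0 (hfin : (Set.range S.cls).Finite) : Finite S.H0 := by
  obtain ⟨c, hc⟩ := S.exists_isLineClass
  -- modulo torsion, three times a class is its degree times the class of a line
  have hsingle : ∀ (P : S.Point) (n : ℤ), ((Finsupp.single P n : S.G) : S.H) = n • S.cls P :=
    fun P n => by
      rw [cls, ← QuotientAddGroup.mk_zsmul]
      simp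
  have htors : ∀ D : S.G, ∃ n : ℤ, n ≠ 0 ∧ n • (3 • (D : S.H) - S.degG D • c) = 0 := by
    intro D
    induction D using Finsupp.induction_linear with
    | zero => exact ⟨1, one_ne_zero, by simp⟩
    | add D E hD hE =>
      obtain ⟨m, hm, hD⟩ := hD
      obtain ⟨n, hn, hE⟩ := hE
      refine ⟨m * n, mul_ne_zero hm hn, ?_⟩
      have e : (m * n) • (3 • ((D + E : S.G) : S.H) - S.degG (D + E) • c) =
          n • (m • (3 • (D : S.H) - S.degG D • c)) + m • (n • (3 • (E : S.H) - S.degG E • c)) := by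
        rw [QuotientAddGroup.mk_add, map_add]
        module
      rw [e, hD, hE, smul_zero, smul_zero, add_zero]
    | single P n =>
      obtain ⟨m, hm, hP⟩ := hc.exists_zsmul_eq_zero hfin P
      refine ⟨m, hm, ?_⟩
      have hdeg : S.degG (Finsupp.single P n) = n := by simp [degG]
      have e : m • (3 • ((Finsupp.single P n : S.G) : S.H) - S.degG (Finsupp.single P n) • c) =
          n • (m • (3 • S.cls P - c)) := by
        rw [hsingle, hdeg]
        module
      rw [e, hP, smul_zero]
  have htop : Submodule.span ℤ (Set.range S.cls) = ⊤ := by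
    rw [eq_top_iff]
    rintro x -
    obtain ⟨D, rfl⟩ := QuotientAddGroup.mk_surjective x
    induction D using Finsupp.induction_linear with
    | zero => exact Submodule.zero_mem _
    | add D E hD hE => rw [QuotientAddGroup.mk_add]; exact Submodule.add_mem _ hD hE
    | single P n =>
      rw [hsingle]
      exact Submodule.smul_mem _ n (Submodule.subset_span ⟨P, rfl⟩)
  have : Module.Finite ℤ S.H := ⟨htop ▸ Submodule.fg_span hfin⟩
  have : Module.Finite ℤ S.H0 :=
    inferInstanceAs (Module.Finite ℤ (AddSubgroup.toIntSubmodule S.H0))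
  refine Module.finite_of_fg_torsion S.H0 fun x => ?_
  obtain ⟨x, hx⟩ := x
  obtain ⟨D, rfl⟩ := QuotientAddGroup.mk_surjective x
  have hdeg : S.degG D = 0 := hx
  obtain ⟨n, hn, hD⟩ := htors D
  rw [hdeg, zero_zsmul, sub_zero] at hD
  refine ⟨⟨n * 3, mem_nonZeroDivisors_of_ne_zero (mul_ne_zero hn three_ne_zero)⟩, ?_⟩
  refine Subtype.ext ?_
  change (n * 3) • (D : S.H) = 0
  rw [← hD]
  module

end SmoothCubicSurface

theorem theorem8 {K : Type*} [Field K] [TopologicalSpace K] (hK : IsLocalField K)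
    (S : SmoothCubicSurface K) :
    Finite S.H0 ∧ IsLocallyConstant S.cls := by
  obtain ⟨_, _, _, hne, ⟨C, hC, hCv⟩, hroots⟩ := hK.hasLocalFieldProperties
  exact ⟨S.finite_H0 (S.finite_range_cls hroots hne hC hCv), S.isLocallyConstant_cls hroots hne⟩
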